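/- Let $d$ be a nonnegative integer and $\kappa\ge 0$. Let $\mathbf U(d)=\{U\in M_d(\mathbb C): UU^*=U^*U=I_d\}$ and $\mathfrak{su}(d)=\{A\in M_d(\mathbb C): A+A^*=0\}$, and let $E=\mathbf U(d)\times\mathfrak{su}(d)$ be equipped with the metric $\mathrm{dist}((U_1,A_1),(U_2,A_2))=\|U_1-U_2\|_2+\|A_1-A_2\|_2$, where $\|\cdot\|_2$ is the Frobenius norm. For $p\ge 1$ let $\mathcal P_p(E)$ be the set of Borel probability measures $\nu$ on $E$ with $\int_E\mathrm{dist}(x_0,x)^p\,\nu(dx)<\infty$ for some $x_0\in E$, and for $\mu,\nu\in\mathcal P_1(E)$ let $$\mathrm{dist}_{MK,1}(\mu,\nu)=\inf_{m\in\Pi(\mu,\nu)}\int_{E\times E}\mathrm{dist}(x,y)\,m(dx\,dy),$$ where $\Pi(\mu,\nu)$ is the set of Borel probability measures on $E\times E$ with marginals $\mu$ and $\nu$. For $V,U\in\mathbf U(d)$ put $K(V,U)=VU^*-UV^*$. The kinetic Lohe equation is $$\partial_t f+\operatorname{div}_U(fAU)+\frac{\kappa}{2}\operatorname{div}_U\Big(f\int_{\mathbf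 U(d)}K(V,U)U\,\rho_f(t,dV)\Big)=0,$$ where $\rho_f(t)$ is the push-forward of $f(t)$ under $(U,A)\mapsto U$. A map $f\in C([0,\infty),(\mathcal P_1(E),\mathrm{dist}_{MK,1}))$ is a weak solution if the equation holds in the sense of distributions on $(0,\infty)\times E$, i.e. if for every $\varphi\in C_c^\infty((0,\infty)\times\mathbf U(d)\times\mathfrak{su}(d))$ $$\int_0^\infty\!\!\int_E\Big[\partial_t\varphi(t,U,A)+\Big(d_U\varphi(t,U,A),\,AU+\tfrac{\kappa}{2}\int_{\mathbf U(d)}K(V,U)U\,\rho_f(t,dV)\Big)\Big]f(t,dU\,dA)\,dt=0 .$$ Then for every $f^0\in\mathcal P_1(E)$ there is exactly one weak solution $f\in C([0,\infty),(\mathcal P_1(E),\mathrm{dist}_{MK,1}))$ of the kinetic Lohe equation with $f(0)=f^0$. Moreover, if $f^0\in\mathcal P_p(E)$ for some real $p\ge 1$, then $f(t)\in\mathcal P_p(E)$ for all $t\ge 0$. -/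

import Mathlib

open MeasureTheory Filter Topology Set
open scoped ENNReal NNReal ContDiff

-- The norm on complex matrices is the Frobenius norm.
attribute [local instance] Matrix.frobeniusNormedAddCommGroup Matrix.frobeniusNormedSpace
  Matrix.frobeniusNormedRing Matrix.frobeniusNormedAlgebra

namespace Lohe

/-- The space `M_d(ℂ)` of complex square matrices of size `d`. -/
abbrev Mat (d : ℕ) : Type := Matrix (Fin d) (Fin d) ℂ

/-- The topology of the Frobenius norm, that is, the usual topology of `M_d(ℂ)`. -/
noncomputable instance (priority := high) instTopologicalSpaceMat (d : ℕ) :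
    TopologicalSpace (Mat d) :=
  (PseudoMetricSpace.toUniformSpace : UniformSpace (Mat d)).toTopologicalSpace

noncomputable instance instMeasurableSpaceMat (d : ℕ) : MeasurableSpace (Mat d) := borel (Mat d)

instance instBorelSpaceMat (d : ℕ) : BorelSpace (Mat d) := ⟨rfl⟩

instance instSecondCountableMat (d : ℕ) : SecondCountableTopology (Mat d) :=
  have : ProperSpace (Mat d) := FiniteDimensional.proper ℝ (Mat d)
  inferInstance

/-- The single-oscillator phase space `E = U(d) × su(d)`: pairs `(U, A)` with `U` unitary and `A`
skew-Hermitian, with the topology and the Borel structure inherited from `M_d(ℂ) × M_d(ℂ)`. -/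
abbrev Phase (d : ℕ) : Type := Matrix.unitaryGroup (Fin d) ℂ × skewAdjoint (Mat d)

instance instSecondCountableSkew (d : ℕ) : SecondCountableTopology (skewAdjoint (Mat d)) :=
  TopologicalSpace.Subtype.secondCountableTopology _

/-- The product σ-algebra on `E` is its Borel σ-algebra. -/
instance instBorelSpacePhase (d : ℕ) : BorelSpace (Phase d) := Prod.borelSpace

/-- The `ℓ¹` distance `‖U₁ - U₂‖₂ + ‖A₁ - A₂‖₂` on `E`, where `‖·‖₂` is the Frobenius norm. -/
noncomputable def phaseDist {d : ℕ} (x y : Phase d) : ℝ :=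
  ‖(x.1 : Mat d) - (y.1 : Mat d)‖ + ‖(x.2 : Mat d) - (y.2 : Mat d)‖

/-- The measure `μ` on `E` has a finite moment of order `p`:
`∫ dist(x₀, x)^p μ(dx) < ∞` for some `x₀`. -/
def HasFiniteMoment {d : ℕ} (p : ℝ) (μ : Measure (Phase d)) : Prop :=
  ∃ x₀ : Phase d, ∫⁻ x, ENNReal.ofReal (phaseDist x₀ x ^ p) ∂μ < ⊤

/-- The set `𝒫₁(E)` of Borel probability measures on `E` with finite first moment. -/
abbrev P1 (d : ℕ) : Type :=
  {μ : ProbabilityMeasure (Phase d) // HasFiniteMoment 1 (μ : Measure (Phase d))}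

/-- The couplings of `μ` and `ν`: measures on `E × E` with marginals `μ` and `ν`. -/
def couplings {d : ℕ} (μ ν : Measure (Phase d)) : Set (Measure (Phase d × Phase d)) :=
  {m | m.fst = μ ∧ m.snd = ν}

/-- The Monge-Kantorovich (Wasserstein) distance of exponent `1`; finite on `𝒫₁(E)`. -/
noncomputable def distMK1 {d : ℕ} (μ ν : Measure (Phase d)) : ℝ≥0∞ :=
  ⨅ m ∈ couplings μ ν, ∫⁻ z, ENNReal.ofReal (phaseDist z.1 z.2) ∂m

/-- `f ∈ C([0,∞), (𝒫₁(E), dist_{MK,1}))`. -/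
def ContinuousMK1 {d : ℕ} (f : ℝ≥0 → P1 d) : Prop :=
  ∀ t : ℝ≥0, Tendsto (fun s : ℝ≥0 => distMK1 (f s).1.toMeasure (f t).1.toMeasure) (𝓝 t) (𝓝 0)

/-- The coupling `K(V, U) = V U* - U V*`. -/
def K {d : ℕ} (V U : Mat d) : Mat d := V * star U - U * star V

/-- The push-forward `ρ_μ` of `μ` under `(U, A) ↦ U`. -/
noncomputable def rho {d : ℕ} (μ : Measure (Phase d)) : Measure (Matrix.unitaryGroup (Fin d) ℂ) :=
  μ.map Prod.fst

/-- The mean-field vector `A U + (κ/2) ∫ K(V, U) U ρ_μ(dV)`, tangent to `U(d)` at `U`. -/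
noncomputable def field {d : ℕ} (κ : ℝ) (μ : Measure (Phase d)) (x : Phase d) : Mat d :=
  (x.2 : Mat d) * (x.1 : Mat d)
    + (κ / 2) • ∫ V : Matrix.unitaryGroup (Fin d) ℂ,
        K (V : Mat d) (x.1 : Mat d) * (x.1 : Mat d) ∂(rho μ)

/-- Test functions on `(0,∞) × U(d) × su(d)`. As `U(d) × su(d)` is a closed embedded submanifold of
the real vector space `M_d(ℂ) × M_d(ℂ)`, its smooth compactly supported functions are exactly the
restrictions of the smooth compactly supported functions of the ambient space, and the derivative
in a tangent direction is that of any extension. -/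
structure IsTestFunction {d : ℕ} (φ : ℝ × Mat d × Mat d → ℝ) : Prop where
  smooth : ContDiff ℝ ∞ φ
  compact : HasCompactSupport φ
  pos_time : tsupport φ ⊆ Ioi (0 : ℝ) ×ˢ univ

/-- `f` solves `∂ₜ f + div_U (f A U) + (κ/2) div_U (f ∫ K(V, U) U ρ_f(t, dV)) = 0` in the sense of
distributions on `(0,∞) × U(d) × su(d)`. -/
def IsWeakSolution {d : ℕ} (κ : ℝ) (f : ℝ≥0 → P1 d) : Prop :=
  ∀ φ : ℝ × Mat d × Mat d → ℝ, IsTestFunction φ →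
    ∫ t in Ioi (0 : ℝ), ∫ x : Phase d,
      (deriv (fun s : ℝ => φ (s, (x.1 : Mat d), (x.2 : Mat d))) t
        + fderiv ℝ (fun W : Mat d => φ (t, W, (x.2 : Mat d))) (x.1 : Mat d)
            (field κ (f t.toNNReal).1.toMeasure x))
      ∂((f t.toNNReal).1.toMeasure) = 0

/-- `f ∈ C([0,∞), (𝒫₁(E), dist_{MK,1}))` is a weak solution of the Cauchy problem for the kinetic
Lohe equation with coupling strength `κ` and initial datum `f₀`. -/
structure IsCauchySolution {d : ℕ} (κ : ℝ) (f₀ : P1 d) (f : ℝ≥0 → P1 d) : Prop where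
  continuous : ContinuousMK1 f
  weak : IsWeakSolution κ f
  initial : f 0 = f₀

end Lohe

/-!
# Well-posedness of the kinetic Lohe equation

Since `K(V, U) U = V - U V* U` is real-linear in `V`, the mean-field vector depends on the measure
only through the matrix `m = ∫ V ρ(dV)`, and a prescribed continuous average `M(t)` turns the
equation into a linear transport equation with characteristics `U' = A U + (κ/2) K(M, U) U`,
`A' = 0`. The coupling is cut off by a scalar function (`coupling`), which makes it bounded and
Lipschitz and keeps the velocity a skew-Hermitian matrix times `U`. Hence `U* U` is conserved
(`mem_unitaryGroup_of_duhamel_eq`) and the cutoff is never felt.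

Existence. The linear part `A U` is unbounded over the phase space, so the characteristics are
written in Duhamel form with the unitary propagators `e^{tA}`. The unknown `U(t, x)`, as a function
of time and of the initial point, is then a fixed point of an operator that contracts in the norm
weighted by `e^{-λt}` (`exists_isDuhamelRate`). The average may be any nonexpansive functional of
`U`: the functional `∫ U(t, x) f₀(dx)` gives the mean-field flow, a constant one gives the flow of
linear transport. The push-forward of `f₀` under the mean-field flow is a weak solution by the chain
rule and Fubini's theorem (`IsFlow.isLinearWeakSolution_push`). As the flow fixes `A` and the
unitary group is bounded, moments propagate (`HasFiniteMoment.map`).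

Uniqueness. A weak solution `f` solves linear transport with `M(t) = ∫ V ρ_f(t, dV)`, and so does
the push-forward of `f₀` under the flow driven by `M`. If linear transport is unique, the two agree,
so that this flow solves the nonlinear Duhamel equation, which has only one solution
(`IsCauchySolution.exists_eq_push`).

Uniqueness for linear transport (`IsLinearSolution.unique`) is proved by duality, without
differentiating the flow. Let `N(t)` be the supremum of `|∫ φ d(f(t) - g(t))|` over smooth `φ` with
`C^{1,1}` bounds in `U` (`TestClass`). This class is stable under composition with an explicit Euler
step of length `h` up to a factor `1 + O(h)` (`TestClass.comp_eulerStep`), and along any solution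
the Euler step is consistent up to `o(h)`, uniformly over the class
(`IsLinearSolution.eventually_abs_pairing_sub_le`). So `N` satisfies Gronwall's inequality, and
vanishes.
-/

namespace Lohe

variable {d : ℕ}

/-! ### The cut-off coupling and the drift -/

theorem norm_le_of_mem_unitaryGroup {U : Mat d} (hU : U ∈ Matrix.unitaryGroup (Fin d) ℂ) :
    ‖U‖ ≤ d := by
  have h : ∑ i, ∑ j, ‖U i j‖ ^ (2 : ℝ) ≤ (d : ℝ) ^ (2 : ℝ) := by
    calc ∑ i, ∑ j, ‖U i j‖ ^ (2 : ℝ) ≤ ∑ _i : Fin d, ∑ _j : Fin d, (1 : ℝ) := by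
          gcongr with i _ j _
          exact Real.rpow_le_one (norm_nonneg _) (entry_norm_bound_of_unitary hU i j) (by norm_num)
      _ = (d : ℝ) ^ (2 : ℝ) := by simp [sq]
  rw [Matrix.frobenius_norm_def]
  calc (∑ i, ∑ j, ‖U i j‖ ^ (2 : ℝ)) ^ (1 / 2 : ℝ) ≤ ((d : ℝ) ^ (2 : ℝ)) ^ (1 / 2 : ℝ) := by
        gcongr
    _ = d := by
        rw [← Real.rpow_mul (by positivity)]; norm_num

theorem norm_coe_unitary_le (U : Matrix.unitaryGroup (Fin d) ℂ) : ‖(U : Mat d)‖ ≤ d :=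
  norm_le_of_mem_unitaryGroup U.2

theorem contDiff_star_mat {n : ℕ∞ω} : ContDiff ℝ n (star : Mat d → Mat d) :=
  (starL' ℝ : Mat d ≃L[ℝ] Mat d).contDiff

/-- A smooth cutoff on `M_d(ℂ)`, equal to one near the ball of radius `d`. This ball contains the
unitary matrices and their averages. -/
noncomputable def cutoff (d : ℕ) : ContDiffBump (0 : Mat d) where
  rIn := d + 1
  rOut := d + 2
  rIn_pos := by positivity
  rIn_lt_rOut := by linarith

theorem cutoff_eq_one {A : Mat d} (hA : ‖A‖ ≤ d) : cutoff d A = 1 := by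
  apply (cutoff d).one_of_mem_closedBall
  simp only [cutoff, mem_closedBall_zero_iff]
  linarith

theorem cutoff_eventuallyEq_one {A : Mat d} (hA : ‖A‖ ≤ d) : cutoff d =ᶠ[𝓝 A] 1 := by
  apply (cutoff d).eventuallyEq_one_of_mem_ball
  simp only [cutoff, mem_ball_zero_iff]
  linarith

theorem contDiff_K : ContDiff ℝ ∞ (fun p : Mat d × Mat d => K p.1 p.2 * p.2) := by
  unfold K
  have h := contDiff_star_mat (d := d) (n := ∞)
  have h1 : ContDiff ℝ ∞ (fun p : Mat d × Mat d => star p.1) := h.comp contDiff_fst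
  have h2 : ContDiff ℝ ∞ (fun p : Mat d × Mat d => star p.2) := h.comp contDiff_snd
  exact ((contDiff_fst.mul h2).sub (contDiff_snd.mul h1)).mul contDiff_snd

/-- The coupling term `K(m, U) U`, cut off to be smooth and compactly supported in `(m, U)`. The
cutoff is scalar, so that the term is still a skew-Hermitian matrix times `U`. -/
noncomputable def coupling (p : Mat d × Mat d) : Mat d :=
  (cutoff d p.1 * cutoff d p.2) • (K p.1 p.2 * p.2)

theorem coupling_eq {m U : Mat d} (hm : ‖m‖ ≤ d) (hU : ‖U‖ ≤ d) :
    coupling (m, U) = K m U * U := by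
  simp [coupling, cutoff_eq_one hm, cutoff_eq_one hU]

theorem contDiff_coupling : ContDiff ℝ ∞ (coupling (d := d)) :=
  (((cutoff d).contDiff.comp contDiff_fst).mul ((cutoff d).contDiff.comp contDiff_snd)).smul
    contDiff_K

theorem hasCompactSupport_coupling : HasCompactSupport (coupling (d := d)) := by
  have : ProperSpace (Mat d) := FiniteDimensional.proper ℝ (Mat d)
  apply HasCompactSupport.intro (isCompact_closedBall (0 : Mat d × Mat d) (d + 2))
  intro p hp
  rw [mem_closedBall_zero_iff, Prod.norm_def, max_le_iff, not_and_or, not_le, not_le] at hp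
  have h0 : ∀ A : Mat d, (d : ℝ) + 2 < ‖A‖ → cutoff d A = 0 := by
    intro A hA
    apply (cutoff d).zero_of_le_dist
    rw [dist_zero_right]
    exact hA.le
  rcases hp with hp | hp <;> simp [coupling, h0 _ hp]

theorem exists_lipschitz_coupling : ∃ L : ℝ≥0, LipschitzWith L (coupling (d := d)) :=
  ContDiff.lipschitzWith_of_hasCompactSupport hasCompactSupport_coupling contDiff_coupling
    (by simp)

theorem exists_bound_coupling : ∃ B : ℝ, ∀ p, ‖coupling (d := d) p‖ ≤ B :=
  hasCompactSupport_coupling.exists_bound_of_continuous contDiff_coupling.continuous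

/-- The average `∫ V ρ_μ(dV)` of the first component under `μ`. The mean-field vector depends on
`μ` only through it. -/
noncomputable def mean (μ : Measure (Phase d)) : Mat d := ∫ x, (x.1 : Mat d) ∂μ

theorem continuous_coe_fst : Continuous fun x : Phase d => (x.1 : Mat d) := by fun_prop

theorem continuous_coe_snd : Continuous fun x : Phase d => (x.2 : Mat d) := by fun_prop

theorem norm_mean_le (μ : Measure (Phase d)) [IsProbabilityMeasure μ] : ‖mean μ‖ ≤ d := by
  refine (norm_integral_le_of_norm_le_const (C := d) ?_).trans (by simp)
  exact ae_of_all _ fun x => norm_coe_unitary_le x.1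

theorem integrable_coe_fst (μ : Measure (Phase d)) [IsProbabilityMeasure μ] :
    Integrable (fun x : Phase d => (x.1 : Mat d)) μ :=
  .of_bound continuous_coe_fst.aestronglyMeasurable d
    (ae_of_all _ fun x => norm_coe_unitary_le x.1)

/-- The mean-field velocity `A U + (κ/2) K(m, U) U` for a given average `m`, extended to the
ambient space with the cut-off coupling. -/
noncomputable def drift (κ : ℝ) (m U A : Mat d) : Mat d := A * U + (κ / 2) • coupling (m, U)

/-- The map `V ↦ K(V, U) U` as a continuous real-linear map. -/
noncomputable def couplingCLM (U : Mat d) : Mat d →L[ℝ] Mat d :=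
  LinearMap.toContinuousLinearMap
    { toFun := fun V => K V U * U
      map_add' := fun V W => by simp only [K, star_add, mul_add, add_mul, sub_mul]; abel
      map_smul' := fun c V => by simp [K, star_smul, sub_mul, smul_sub] }

theorem field_eq_drift (κ : ℝ) (μ : Measure (Phase d)) [IsProbabilityMeasure μ] (x : Phase d) :
    field κ μ x = drift κ (mean μ) x.1 x.2 := by
  rw [field, drift, coupling_eq (norm_mean_le μ) (norm_coe_unitary_le x.1), rho,
    integral_map measurable_fst.aemeasurable]
  · congr 2
    exact (couplingCLM (x.1 : Mat d)).integral_comp_comm (integrable_coe_fst μ)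
  · apply Continuous.aestronglyMeasurable
    exact (couplingCLM (x.1 : Mat d)).continuous.comp continuous_subtype_val

/-- The drift is a skew-Hermitian matrix times `U`. -/
theorem exists_skew_drift (κ : ℝ) (m U : Mat d) {A : Mat d} (hA : A ∈ skewAdjoint (Mat d)) :
    ∃ S ∈ skewAdjoint (Mat d), drift κ m U A = S * U := by
  refine ⟨A + (κ / 2) • (cutoff d m * cutoff d U) • K m U, ?_, ?_⟩
  · apply add_mem hA
    have hK : K m U ∈ skewAdjoint (Mat d) := by
      rw [skewAdjoint.mem_iff]
      simp [K]
    exact skewAdjoint.smul_mem _ (skewAdjoint.smul_mem _ hK)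
  · simp [drift, coupling, add_mul]

theorem exp_mem_unitaryGroup (t : ℝ) {A : Mat d} (hA : A ∈ skewAdjoint (Mat d)) :
    NormedSpace.exp (t • A) ∈ Matrix.unitaryGroup (Fin d) ℂ := by
  have : NormedAlgebra ℚ (Mat d) := NormedAlgebra.restrictScalars ℚ ℝ (Mat d)
  exact NormedSpace.exp_mem_unitary_of_mem_skewAdjoint (skewAdjoint.smul_mem t hA)

/-! ### Fixed points in weighted norms -/

/-- Continuous maps on `[0,∞) × X` which grow at most like `e^{λt}` in time, uniformly in `X`. -/
structure ExpBounded {X B : Type*} [TopologicalSpace X] [NormedAddCommGroup B] (lam : ℝ)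
    (U : ℝ≥0 × X → B) : Prop where
  continuous : Continuous U
  bound : ∃ C, ∀ p, ‖U p‖ ≤ C * Real.exp (lam * p.1)

/-- Banach's fixed point theorem for the norm weighted by `e^{-λt}`. -/
theorem existsUnique_fixedPoint_of_expBounded {X B : Type*} [TopologicalSpace X]
    [NormedAddCommGroup B] [NormedSpace ℝ B] [CompleteSpace B] {lam : ℝ}
    (Ψ : (ℝ≥0 × X → B) → ℝ≥0 × X → B)
    (hΨ : ∀ U, ExpBounded lam U → ExpBounded lam (Ψ U))
    (hc : ∀ U V, ExpBounded lam U → ExpBounded lam V → ∀ D,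
      (∀ p, ‖U p - V p‖ ≤ D * Real.exp (lam * p.1)) →
      ∀ p, ‖Ψ U p - Ψ V p‖ ≤ D / 2 * Real.exp (lam * p.1)) :
    ∃! U, ExpBounded lam U ∧ Ψ U = U := by
  let w : ℝ≥0 × X → ℝ := fun p => Real.exp (lam * p.1)
  have hw : Continuous w := by fun_prop
  have hw0 : ∀ p, 0 < w p := fun p => Real.exp_pos _
  let lift : BoundedContinuousFunction (ℝ≥0 × X) B → ℝ≥0 × X → B := fun Y p => w p • Y p
  have hlift : ∀ Y, ExpBounded lam (lift Y) := fun Y => by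
    refine ⟨hw.smul Y.continuous, ‖Y‖, fun p => ?_⟩
    rw [norm_smul, Real.norm_of_nonneg (hw0 p).le, mul_comm]
    exact mul_le_mul_of_nonneg_right (Y.norm_coe_le_norm p) (hw0 p).le
  have hdiv : ∀ (z : B) (C : ℝ) (p : ℝ≥0 × X), ‖z‖ ≤ C * w p → ‖(w p)⁻¹ • z‖ ≤ C := by
    intro z C p h
    rw [norm_smul, norm_inv, Real.norm_of_nonneg (hw0 p).le, inv_mul_le_iff₀ (hw0 p), mul_comm]
    exact h
  have hex : ∀ U, ExpBounded lam U →
      ∃ Y : BoundedContinuousFunction (ℝ≥0 × X) B, ∀ p, Y p = (w p)⁻¹ • U p := by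
    rintro U ⟨hU, C, hC⟩
    exact ⟨.ofNormedAddCommGroup (fun p => (w p)⁻¹ • U p)
      ((hw.inv₀ fun p => (hw0 p).ne').smul hU) C (fun p => hdiv _ _ p (hC p)), fun p => rfl⟩
  choose Φ hΦ using fun Y => hex _ (hΨ _ (hlift Y))
  have hcontr : ContractingWith (1 / 2) Φ := by
    refine ⟨by rw [div_lt_one] <;> norm_num, LipschitzWith.of_dist_le_mul fun Y Z => ?_⟩
    rw [BoundedContinuousFunction.dist_le (by positivity)]
    intro p
    rw [dist_eq_norm, hΦ, hΦ, ← smul_sub]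
    apply hdiv
    have := hc _ _ (hlift Y) (hlift Z) (dist Y Z) (fun q => ?_) p
    · refine this.trans (le_of_eq ?_)
      push_cast; ring
    · rw [← smul_sub, norm_smul, Real.norm_of_nonneg (hw0 q).le, mul_comm, ← dist_eq_norm]
      exact mul_le_mul_of_nonneg_right (Y.dist_coe_le_dist q) (hw0 q).le
  have : Nonempty (BoundedContinuousFunction (ℝ≥0 × X) B) := ⟨0⟩
  have hfix : ∀ Y, Φ Y = Y → Ψ (lift Y) = lift Y := fun Y hY => by
    ext1 p
    have := hΦ Y p
    rw [hY] at this
    rw [show lift Y p = w p • Y p from rfl, this, smul_inv_smul₀ (hw0 p).ne']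
  refine ⟨lift (ContractingWith.fixedPoint Φ hcontr), ⟨hlift _, hfix _ hcontr.fixedPoint_isFixedPt⟩,
    fun U hU => ?_⟩
  obtain ⟨Y, hY⟩ := hex U hU.1
  have hUY : U = lift Y := by
    ext1 p
    rw [show lift Y p = w p • Y p from rfl, hY, smul_inv_smul₀ (hw0 p).ne']
  have hYfix : Φ Y = Y := by
    ext1 p
    rw [hΦ, hY, ← hUY, hU.2]
  rw [hUY, hcontr.fixedPoint_unique hYfix]

/-! ### Duhamel's equation -/

/-- The right-hand side of Duhamel's formula for `∂ₜ U = A U + (κ/2) K(M, U) U`, `U(0) = U₀`, with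
the cut-off coupling and with the linear part solved exactly. -/
noncomputable def duhamel (κ : ℝ) (M : ℝ≥0 → Mat d) (U : ℝ≥0 × Phase d → Mat d)
    (p : ℝ≥0 × Phase d) : Mat d :=
  NormedSpace.exp ((p.1 : ℝ) • (p.2.2 : Mat d)) * ((p.2.1 : Mat d) + (κ / 2) •
    ∫ s in (0 : ℝ)..p.1, NormedSpace.exp ((-s) • (p.2.2 : Mat d)) *
      coupling (M s.toNNReal, U (s.toNNReal, p.2)))

theorem norm_exp_le (t : ℝ) (A : skewAdjoint (Mat d)) :
    ‖NormedSpace.exp (t • (A : Mat d))‖ ≤ d :=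
  norm_le_of_mem_unitaryGroup (exp_mem_unitaryGroup t A.2)

theorem continuous_exp_mat : Continuous (NormedSpace.exp : Mat d → Mat d) := by
  have : NormedAlgebra ℚ (Mat d) := NormedAlgebra.restrictScalars ℚ ℝ (Mat d)
  exact NormedSpace.exp_continuous

theorem continuous_duhamel_integrand {M : ℝ≥0 → Mat d} {U : ℝ≥0 × Phase d → Mat d}
    (hM : Continuous M) (hU : Continuous U) :
    Continuous fun q : (ℝ≥0 × Phase d) × ℝ => NormedSpace.exp ((-q.2) • (q.1.2.2 : Mat d)) *
      coupling (M q.2.toNNReal, U (q.2.toNNReal, q.1.2)) := by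
  have h1 : Continuous fun q : (ℝ≥0 × Phase d) × ℝ => (-q.2) • (q.1.2.2 : Mat d) := by fun_prop
  have h2 : Continuous fun q : (ℝ≥0 × Phase d) × ℝ => q.2.toNNReal :=
    continuous_real_toNNReal.comp continuous_snd
  have h3 : Continuous fun q : (ℝ≥0 × Phase d) × ℝ => U (q.2.toNNReal, q.1.2) :=
    hU.comp (h2.prodMk (continuous_snd.comp continuous_fst))
  exact (continuous_exp_mat.comp h1).mul
    (contDiff_coupling.continuous.comp ((hM.comp h2).prodMk h3))

theorem continuous_duhamel (κ : ℝ) {M : ℝ≥0 → Mat d} {U : ℝ≥0 × Phase d → Mat d}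
    (hM : Continuous M) (hU : Continuous U) : Continuous (duhamel κ M U) := by
  have h1 : Continuous fun p : ℝ≥0 × Phase d => (p.1 : ℝ) • (p.2.2 : Mat d) := by fun_prop
  have h2 : Continuous fun p : ℝ≥0 × Phase d => (p.2.1 : Mat d) := by fun_prop
  have h3 := intervalIntegral.continuous_parametric_intervalIntegral_of_continuous (a₀ := 0)
    (μ := volume)
    (f := fun (p : ℝ≥0 × Phase d) (s : ℝ) => NormedSpace.exp ((-s) • (p.2.2 : Mat d)) *
      coupling (M s.toNNReal, U (s.toNNReal, p.2))) (continuous_duhamel_integrand hM hU)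
    (s := fun p : ℝ≥0 × Phase d => (p.1 : ℝ)) (by fun_prop)
  exact (continuous_exp_mat.comp h1).mul (h2.add (h3.const_smul (κ / 2)))

theorem continuous_duhamel_integrand_time {M : ℝ≥0 → Mat d} {U : ℝ≥0 × Phase d → Mat d}
    (hM : Continuous M) (hU : Continuous U) (x : Phase d) :
    Continuous fun s : ℝ => NormedSpace.exp ((-s) • (x.2 : Mat d)) *
      coupling (M s.toNNReal, U (s.toNNReal, x)) :=
  (continuous_duhamel_integrand hM hU).comp (f := fun s : ℝ => (((0 : ℝ≥0), x), s)) (by fun_prop)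

theorem integral_exp_le {lam : ℝ} (hl : 0 < lam) (t : ℝ) :
    ∫ s in (0 : ℝ)..t, Real.exp (lam * s) ≤ Real.exp (lam * t) / lam := by
  have h : ∀ s ∈ uIcc 0 t, HasDerivAt (fun s => Real.exp (lam * s) / lam) (Real.exp (lam * s)) s := by
    intro s _
    have := (((hasDerivAt_id s).const_mul lam).exp).div_const lam
    simpa [hl.ne'] using this
  rw [intervalIntegral.integral_eq_sub_of_hasDerivAt h
    (Continuous.intervalIntegrable (by fun_prop) _ _)]
  have : 0 < Real.exp (lam * 0) / lam := by positivity
  linarith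

theorem norm_duhamel_sub_le {κ : ℝ} (hκ : 0 ≤ κ) {L : ℝ≥0}
    (hL : LipschitzWith L (coupling (d := d))) {lam : ℝ} (hl : 0 < lam) {M N : ℝ≥0 → Mat d}
    {U V : ℝ≥0 × Phase d → Mat d} (hM : Continuous M) (hN : Continuous N) (hU : Continuous U)
    (hV : Continuous V) {D : ℝ} (hMN : ∀ t : ℝ≥0, ‖M t - N t‖ ≤ D * Real.exp (lam * t))
    (hUV : ∀ p, ‖U p - V p‖ ≤ D * Real.exp (lam * p.1)) (p : ℝ≥0 × Phase d) :
    ‖duhamel κ M U p - duhamel κ N V p‖ ≤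
      (d : ℝ) ^ 2 * κ * L / 2 / lam * (D * Real.exp (lam * p.1)) := by
  obtain ⟨t, x⟩ := p
  have hi := continuous_duhamel_integrand_time hM hU x
  have hj := continuous_duhamel_integrand_time hN hV x
  have hint : ‖(∫ s in (0 : ℝ)..t, NormedSpace.exp ((-s) • (x.2 : Mat d)) *
        coupling (M s.toNNReal, U (s.toNNReal, x))) -
      ∫ s in (0 : ℝ)..t, NormedSpace.exp ((-s) • (x.2 : Mat d)) *
        coupling (N s.toNNReal, V (s.toNNReal, x))‖ ≤
      ∫ s in (0 : ℝ)..t, (d * L * D) * Real.exp (lam * s) := by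
    rw [← intervalIntegral.integral_sub (hi.intervalIntegrable _ _) (hj.intervalIntegrable _ _)]
    refine intervalIntegral.norm_integral_le_of_norm_le t.2 (ae_of_all _ fun s hs => ?_)
      (Continuous.intervalIntegrable (by fun_prop) _ _)
    rw [← mul_sub]
    have hs0 : ((s.toNNReal : ℝ≥0) : ℝ) = s := Real.coe_toNNReal _ hs.1.le
    calc _ ≤ (d : ℝ) * (L * (D * Real.exp (lam * s))) := by
          refine (norm_mul_le _ _).trans
            (mul_le_mul (norm_exp_le _ _) ?_ (norm_nonneg _) (by positivity))
          refine (hL.norm_sub_le _ _).trans ?_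
          gcongr
          refine max_le ?_ ?_
          · simpa [hs0] using hMN s.toNNReal
          · simpa [hs0] using hUV (s.toNNReal, x)
      _ = _ := by ring
  rw [intervalIntegral.integral_const_mul] at hint
  have hD : 0 ≤ D := by
    have := (norm_nonneg _).trans (hMN 0)
    simpa using this
  calc _ = ‖NormedSpace.exp ((t : ℝ) • (x.2 : Mat d)) * ((κ / 2) •
        ((∫ s in (0 : ℝ)..t, NormedSpace.exp ((-s) • (x.2 : Mat d)) *
          coupling (M s.toNNReal, U (s.toNNReal, x))) -
        ∫ s in (0 : ℝ)..t, NormedSpace.exp ((-s) • (x.2 : Mat d)) *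
          coupling (N s.toNNReal, V (s.toNNReal, x))))‖ := by
        simp only [duhamel, ← mul_sub, smul_sub, add_sub_add_left_eq_sub]
    _ ≤ d * (κ / 2 * ((d * L * D) * (Real.exp (lam * t) / lam))) := by
        refine (norm_mul_le _ _).trans
          (mul_le_mul (norm_exp_le _ _) ?_ (norm_nonneg _) (by positivity))
        rw [norm_smul, Real.norm_of_nonneg (by positivity)]
        gcongr
        refine hint.trans ?_
        gcongr
        exact integral_exp_le hl _
    _ = _ := by ring

theorem norm_duhamel_le {κ : ℝ} (hκ : 0 ≤ κ) {B : ℝ} (hB : ∀ p, ‖coupling (d := d) p‖ ≤ B)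
    (M : ℝ≥0 → Mat d) (U : ℝ≥0 × Phase d → Mat d) (p : ℝ≥0 × Phase d) :
    ‖duhamel κ M U p‖ ≤ d * (d + κ / 2 * (d * B * p.1)) := by
  refine (norm_mul_le _ _).trans (mul_le_mul (norm_exp_le _ _) ?_ (norm_nonneg _) (by positivity))
  refine (norm_add_le _ _).trans (add_le_add (norm_coe_unitary_le _) ?_)
  rw [norm_smul, Real.norm_of_nonneg (by positivity)]
  gcongr
  refine (intervalIntegral.norm_integral_le_of_norm_le_const (C := d * B) fun s _ => ?_).trans ?_
  · exact (norm_mul_le _ _).trans (mul_le_mul (norm_exp_le _ _) (hB _) (norm_nonneg _)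
      (by positivity))
  · simp

/-- `lam` is a growth rate for which Duhamel's equation is well posed whenever the average is a
functional `𝓜 U` of the unknown which is nonexpansive for the weight `e^{-lam t}`. A constant
functional gives the linear transport flow, and `𝓜 U = ∫ U df₀` the mean-field flow. -/
def IsDuhamelRate (d : ℕ) (κ lam : ℝ) : Prop :=
  ∀ 𝓜 : (ℝ≥0 × Phase d → Mat d) → ℝ≥0 → Mat d,
    (∀ U, ExpBounded lam U → Continuous (𝓜 U)) →
    (∀ U V, ExpBounded lam U → ExpBounded lam V → ∀ D,
      (∀ p, ‖U p - V p‖ ≤ D * Real.exp (lam * p.1)) →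
      ∀ t : ℝ≥0, ‖𝓜 U t - 𝓜 V t‖ ≤ D * Real.exp (lam * t)) →
    ∃! U, ExpBounded lam U ∧ duhamel κ (𝓜 U) U = U

/-- Large rates work: the Lipschitz constant of Duhamel's operator in the weighted norm is
`O(1 / lam)`, because the propagators `e^{tA}` are bounded uniformly in `A`. -/
theorem exists_isDuhamelRate (d : ℕ) {κ : ℝ} (hκ : 0 ≤ κ) :
    ∃ lam : ℝ, 0 ≤ lam ∧ IsDuhamelRate d κ lam := by
  obtain ⟨L, hL⟩ := exists_lipschitz_coupling (d := d)
  obtain ⟨B, hB⟩ := exists_bound_coupling (d := d)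
  have hB0 : 0 ≤ B := (norm_nonneg _).trans (hB 0)
  have hl : 1 ≤ (d : ℝ) ^ 2 * κ * L + 1 := by
    have : 0 ≤ (d : ℝ) ^ 2 * κ * L := by positivity
    linarith
  refine ⟨_, zero_le_one.trans hl, fun 𝓜 hc hlip => ?_⟩
  set lam := (d : ℝ) ^ 2 * κ * L + 1 with hlam
  have hl0 : 0 < lam := by linarith
  refine existsUnique_fixedPoint_of_expBounded (fun U => duhamel κ (𝓜 U) U) ?_ ?_
  · intro U hU
    refine ⟨continuous_duhamel κ (hc U hU) hU.continuous, d * d + d * (κ / 2 * (d * B)),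
      fun p => (norm_duhamel_le hκ hB _ _ p).trans ?_⟩
    have h1 : 1 ≤ Real.exp (lam * p.1) := Real.one_le_exp (by positivity)
    have h2 : (p.1 : ℝ) ≤ Real.exp (lam * p.1) := by
      have h3 := Real.add_one_le_exp (lam * p.1)
      have h4 : (p.1 : ℝ) ≤ lam * p.1 := le_mul_of_one_le_left p.1.2 hl
      linarith
    calc _ = (d : ℝ) * d * 1 + d * (κ / 2 * (d * B)) * p.1 := by ring
      _ ≤ (d : ℝ) * d * Real.exp (lam * p.1) + d * (κ / 2 * (d * B)) * Real.exp (lam * p.1) := by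
        gcongr
      _ = _ := by ring
  · intro U V hU hV D hD p
    refine (norm_duhamel_sub_le hκ hL hl0 (hc U hU) (hc V hV) hU.continuous hV.continuous
      (hlip U V hU hV D hD) hD p).trans ?_
    have hD0 : 0 ≤ D * Real.exp (lam * p.1) := (norm_nonneg _).trans (hD p)
    have : (d : ℝ) ^ 2 * κ * L / 2 / lam ≤ 1 / 2 := by
      rw [div_le_iff₀ hl0]
      linarith
    calc _ ≤ 1 / 2 * (D * Real.exp (lam * p.1)) := by gcongr
      _ = _ := by ring

/-! ### Unitarity and the flow on the phase space -/

theorem hasDerivAt_exp_smul_mat (A : Mat d) (t : ℝ) :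
    HasDerivAt (fun t : ℝ => NormedSpace.exp (t • A)) (A * NormedSpace.exp (t • A)) t :=
  hasDerivAt_exp_smul_const' A t

theorem exp_mul_exp_neg_smul (A : Mat d) (t : ℝ) :
    NormedSpace.exp (t • A) * NormedSpace.exp ((-t) • A) = 1 := by
  have : NormedAlgebra ℚ (Mat d) := NormedAlgebra.restrictScalars ℚ ℝ (Mat d)
  rw [← NormedSpace.exp_add_of_commute, ← add_smul, add_neg_cancel, zero_smul, NormedSpace.exp_zero]
  exact ((Commute.refl A).smul_left t).smul_right (-t)

/-- The fixed points of Duhamel's formula solve the differential equation; at `t = 0` the derivative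
is one-sided. -/
theorem hasDerivWithinAt_of_duhamel_eq {κ : ℝ} {M : ℝ≥0 → Mat d}
    {U : ℝ≥0 × Phase d → Mat d} (hM : Continuous M) (hU : Continuous U)
    (hfix : duhamel κ M U = U) (x : Phase d) {t : ℝ} (ht : 0 ≤ t) :
    HasDerivWithinAt (fun s : ℝ => U (s.toNNReal, x))
      (drift κ (M t.toNNReal) (U (t.toNNReal, x)) x.2) (Ici 0) t := by
  let G : ℝ → Mat d := fun t => NormedSpace.exp (t • (x.2 : Mat d)) * ((x.1 : Mat d) + (κ / 2) •
    ∫ s in (0 : ℝ)..t, NormedSpace.exp ((-s) • (x.2 : Mat d)) *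
      coupling (M s.toNNReal, U (s.toNNReal, x)))
  have hGU : ∀ s ∈ Ici (0 : ℝ), U (s.toNNReal, x) = G s := fun s hs => by
    conv_lhs => rw [← hfix]
    simp only [duhamel, G, Real.coe_toNNReal s hs]
  have hc := continuous_duhamel_integrand_time hM hU x
  have hint := intervalIntegral.integral_hasDerivAt_right (hc.intervalIntegrable 0 t)
    hc.aestronglyMeasurable.stronglyMeasurableAtFilter hc.continuousAt
  have hG : HasDerivAt G ((x.2 : Mat d) * G t + (κ / 2) • coupling (M t.toNNReal, G t)) t := by
    have := (hasDerivAt_exp_smul_mat (x.2 : Mat d) t).mul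
      ((hint.const_smul (κ / 2)).const_add (x.1 : Mat d))
    refine this.congr_deriv ?_
    rw [mul_assoc, mul_smul_comm, ← mul_assoc (NormedSpace.exp (t • (x.2 : Mat d))),
      exp_mul_exp_neg_smul, one_mul, hGU t ht]
    rfl
  rw [drift, hGU t ht]
  exact hG.hasDerivWithinAt.congr hGU (hGU t ht)

theorem hasDerivAt_of_duhamel_eq {κ : ℝ} {M : ℝ≥0 → Mat d}
    {U : ℝ≥0 × Phase d → Mat d} (hM : Continuous M) (hU : Continuous U)
    (hfix : duhamel κ M U = U) (x : Phase d) {t : ℝ} (ht : 0 < t) :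
    HasDerivAt (fun s : ℝ => U (s.toNNReal, x))
      (drift κ (M t.toNNReal) (U (t.toNNReal, x)) x.2) t :=
  (hasDerivWithinAt_of_duhamel_eq hM hU hfix x ht.le).hasDerivAt (Ici_mem_nhds ht)

theorem apply_zero_of_duhamel_eq {κ : ℝ} {M : ℝ≥0 → Mat d} {U : ℝ≥0 × Phase d → Mat d}
    (hfix : duhamel κ M U = U) (x : Phase d) : U (0, x) = x.1 := by
  rw [← hfix]
  simp [duhamel, NormedSpace.exp_zero]

/-- The velocity is a skew-Hermitian matrix times `U`, so `U* U` is conserved. -/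
theorem mem_unitaryGroup_of_duhamel_eq {κ : ℝ} {M : ℝ≥0 → Mat d}
    {U : ℝ≥0 × Phase d → Mat d} (hM : Continuous M) (hU : Continuous U)
    (hfix : duhamel κ M U = U) (x : Phase d) (t : ℝ≥0) :
    U (t, x) ∈ Matrix.unitaryGroup (Fin d) ℂ := by
  let u : ℝ → Mat d := fun s => U (s.toNNReal, x)
  have hu : ∀ s, 0 ≤ s → HasDerivWithinAt u (drift κ (M s.toNNReal) (u s) x.2) (Ici 0) s :=
    fun s hs => hasDerivWithinAt_of_duhamel_eq hM hU hfix x hs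
  have hd : ∀ s, 0 ≤ s → HasDerivWithinAt (fun s => star (u s) * u s) 0 (Ici 0) s := by
    intro s hs
    obtain ⟨S, hS, hSu⟩ := exists_skew_drift κ (M s.toNNReal) (u s) x.2.2
    have h1 := hu s hs
    have h2 : HasDerivWithinAt (fun s => star (u s)) (star (drift κ (M s.toNNReal) (u s) x.2))
        (Ici 0) s :=
      ((starL' ℝ : Mat d ≃L[ℝ] Mat d).toContinuousLinearMap.hasFDerivAt).comp_hasDerivWithinAt s h1
    refine (h2.mul h1).congr_deriv ?_
    rw [hSu, star_mul, skewAdjoint.mem_iff.1 hS]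
    simp [mul_assoc]
  have hconst := constant_of_has_deriv_right_zero (f := fun s => star (u s) * u s)
    (a := 0) (b := (t : ℝ)) (fun s hs => ((hd s hs.1).continuousWithinAt).mono Icc_subset_Ici_self)
    (fun s hs => (hd s hs.1).mono (Ici_subset_Ici.2 hs.1)) t ⟨t.2, le_rfl⟩
  simp only [u, Real.toNNReal_coe, Real.toNNReal_zero, apply_zero_of_duhamel_eq hfix x] at hconst
  rw [Matrix.mem_unitaryGroup_iff', hconst]
  exact Matrix.mem_unitaryGroup_iff'.1 x.1.2

/-- `T` is the flow on the phase space of `U' = A U + (κ/2) K(M(t), U) U`, `A' = 0`. The equation is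
encoded in Duhamel form, with the cut-off coupling; the cutoff equals one when `‖M(t)‖ ≤ d`. -/
structure IsFlow (κ : ℝ) (M : ℝ≥0 → Mat d) (T : ℝ≥0 → Phase d → Phase d) : Prop where
  continuous : Continuous fun p : ℝ≥0 × Phase d => T p.1 p.2
  zero : ∀ x, T 0 x = x
  snd : ∀ t x, (T t x).2 = x.2
  duhamel : duhamel κ M (fun p => ((T p.1 p.2).1 : Mat d)) = fun p => ((T p.1 p.2).1 : Mat d)

theorem IsFlow.hasDerivAt {κ : ℝ} {M : ℝ≥0 → Mat d} {T : ℝ≥0 → Phase d → Phase d}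
    (hT : IsFlow κ M T) (hM : Continuous M) (x : Phase d) {t : ℝ} (ht : 0 < t) :
    HasDerivAt (fun s : ℝ => ((T s.toNNReal x).1 : Mat d))
      (drift κ (M t.toNNReal) (T t.toNNReal x).1 (T t.toNNReal x).2) t := by
  rw [hT.snd]
  exact hasDerivAt_of_duhamel_eq hM (continuous_coe_fst.comp hT.continuous) hT.duhamel x ht

theorem exists_isFlow {κ : ℝ} {M : ℝ≥0 → Mat d} {U : ℝ≥0 × Phase d → Mat d} (hM : Continuous M)
    (hU : Continuous U) (hfix : duhamel κ M U = U) :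
    ∃ T, IsFlow κ M T ∧ ∀ t x, ((T t x).1 : Mat d) = U (t, x) := by
  refine ⟨fun t x => (⟨U (t, x), mem_unitaryGroup_of_duhamel_eq hM hU hfix x t⟩, x.2),
    ⟨?_, fun x => ?_, fun t x => rfl, hfix⟩, fun t x => rfl⟩
  · exact (hU.subtype_mk _).prodMk (continuous_snd.comp continuous_snd)
  · exact Prod.ext (Subtype.ext (apply_zero_of_duhamel_eq hfix x)) rfl

/-! ### The Monge-Kantorovich distance and push-forwards -/

theorem phaseDist_nonneg (x y : Phase d) : 0 ≤ phaseDist x y := by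
  unfold phaseDist; positivity

theorem continuous_phaseDist_comp {X : Type*} [TopologicalSpace X] {a b : X → Phase d}
    (ha : Continuous a) (hb : Continuous b) : Continuous fun s => phaseDist (a s) (b s) := by
  unfold phaseDist
  exact (((continuous_coe_fst.comp ha).sub (continuous_coe_fst.comp hb)).norm).add
    (((continuous_coe_snd.comp ha).sub (continuous_coe_snd.comp hb)).norm)

theorem continuous_phaseDist : Continuous fun z : Phase d × Phase d => phaseDist z.1 z.2 :=
  continuous_phaseDist_comp continuous_fst continuous_snd

/-- The easy half of Kantorovich duality, for functions with values in a normed space. -/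
theorem enorm_integral_sub_integral_le {G : Type*} [NormedAddCommGroup G] [NormedSpace ℝ G]
    {μ ν : Measure (Phase d)} {ζ : Phase d → G} (hμ : Integrable ζ μ) (hν : Integrable ζ ν)
    {L : ℝ≥0} (hL0 : L ≠ 0) (hL : ∀ x y, ‖ζ x - ζ y‖ ≤ L * phaseDist x y) :
    ‖∫ x, ζ x ∂μ - ∫ x, ζ x ∂ν‖ₑ ≤ L * distMK1 μ ν := by
  unfold distMK1
  have hL0' : (L : ℝ≥0∞) ≠ 0 := by exact_mod_cast hL0
  rw [ENNReal.mul_iInf_of_ne hL0' ENNReal.coe_ne_top]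
  refine le_iInf fun m => ?_
  rw [ENNReal.mul_iInf_of_ne hL0' ENNReal.coe_ne_top]
  refine le_iInf fun hm => ?_
  obtain ⟨rfl, rfl⟩ := hm
  have h1 : Integrable (fun z : Phase d × Phase d => ζ z.1) m :=
    hμ.comp_measurable measurable_fst
  have h2 : Integrable (fun z : Phase d × Phase d => ζ z.2) m :=
    hν.comp_measurable measurable_snd
  rw [Measure.fst, Measure.snd, integral_map measurable_fst.aemeasurable hμ.1,
    integral_map measurable_snd.aemeasurable hν.1, ← integral_sub h1 h2]
  refine (enorm_integral_le_lintegral_enorm _).trans ?_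
  rw [← lintegral_const_mul' _ _ ENNReal.coe_ne_top]
  refine lintegral_mono fun z => ?_
  rw [← ofReal_norm]
  refine (ENNReal.ofReal_le_ofReal (hL z.1 z.2)).trans ?_
  rw [ENNReal.ofReal_mul (NNReal.coe_nonneg L), ENNReal.ofReal_coe_nnreal]

/-- Integrals of a family of bounded functions, Lipschitz in space and continuous in time uniformly
in space, along an `MK,1`-continuous curve. -/
theorem ContinuousMK1.continuous_integral {f : ℝ≥0 → P1 d} (hf : ContinuousMK1 f)
    {G G' : Type*} [NormedAddCommGroup G] [NormedSpace ℝ G] [NormedAddCommGroup G']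
    {Z : ℝ≥0 → Phase d → G} {M : ℝ≥0 → G'} (hM : Continuous M)
    (hi : ∀ s t, Integrable (Z s) (f t).1.toMeasure) {L : ℝ≥0}
    (hL : ∀ t x y, ‖Z t x - Z t y‖ ≤ L * phaseDist x y)
    (hZM : ∀ s t x, ‖Z s x - Z t x‖ ≤ L * ‖M s - M t‖) :
    Continuous fun t => ∫ x, Z t x ∂(f t).1.toMeasure := by
  rw [continuous_iff_continuousAt]
  intro t
  have h1 : Tendsto (fun s => ∫ x, Z s x ∂(f s).1.toMeasure - ∫ x, Z t x ∂(f s).1.toMeasure)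
      (𝓝 t) (𝓝 0) := by
    have hlim : Tendsto (fun s => L * ‖M s - M t‖) (𝓝 t) (𝓝 0) := by
      have : Continuous fun s => L * ‖M s - M t‖ := by fun_prop
      simpa using this.tendsto t
    refine squeeze_zero_norm (fun s => ?_) hlim
    rw [← integral_sub (hi _ _) (hi _ _)]
    refine (norm_integral_le_of_norm_le_const (ae_of_all _ fun x => hZM s t x)).trans ?_
    simp
  have h2 : Tendsto (fun s => ∫ x, Z t x ∂(f s).1.toMeasure - ∫ x, Z t x ∂(f t).1.toMeasure)
      (𝓝 t) (𝓝 0) := by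
    rw [tendsto_zero_iff_enorm_tendsto_zero]
    have hlim : Tendsto (fun s => ((L + 1 : ℝ≥0) : ℝ≥0∞) *
        distMK1 (f s).1.toMeasure (f t).1.toMeasure) (𝓝 t) (𝓝 0) := by
      have := ENNReal.Tendsto.const_mul (hf t) (Or.inr (ENNReal.coe_ne_top (r := L + 1)))
      rwa [mul_zero] at this
    refine tendsto_of_tendsto_of_tendsto_of_le_of_le tendsto_const_nhds hlim
      (fun s => zero_le) fun s => ?_
    refine enorm_integral_sub_integral_le (hi _ _) (hi _ _) (by positivity) fun x y =>
      (hL t x y).trans ?_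
    have := phaseDist_nonneg x y
    gcongr
    exact le_self_add
  have h3 := (h1.add h2).add_const (∫ x, Z t x ∂(f t).1.toMeasure)
  rw [ContinuousAt]
  simpa using h3

theorem ContinuousMK1.continuous_mean {f : ℝ≥0 → P1 d} (hf : ContinuousMK1 f) :
    Continuous fun t => mean (f t).1.toMeasure := by
  refine hf.continuous_integral (M := fun _ => (0 : ℝ)) continuous_const
    (fun s t => integrable_coe_fst _) (L := 1) (fun t x y => ?_) (fun s t x => by simp)
  simp [phaseDist]

theorem phaseDist_triangle (x y z : Phase d) :
    phaseDist x z ≤ phaseDist x y + phaseDist y z := by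
  unfold phaseDist
  have h1 := norm_sub_le_norm_sub_add_norm_sub (x.1 : Mat d) y.1 z.1
  have h2 := norm_sub_le_norm_sub_add_norm_sub (x.2 : Mat d) y.2 z.2
  linarith

theorem phaseDist_le_of_snd_eq {x y : Phase d} (h : x.2 = y.2) : phaseDist x y ≤ 2 * d := by
  unfold phaseDist
  rw [h, sub_self, norm_zero, add_zero]
  refine (norm_sub_le _ _).trans ?_
  linarith [norm_coe_unitary_le x.1, norm_coe_unitary_le y.1]

theorem HasFiniteMoment.map {p : ℝ} (hp : 1 ≤ p) {μ : Measure (Phase d)} [IsFiniteMeasure μ]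
    (hμ : HasFiniteMoment p μ) {S : Phase d → Phase d} (hS : Measurable S)
    (hS2 : ∀ x, (S x).2 = x.2) : HasFiniteMoment p (μ.map S) := by
  obtain ⟨x₀, hx₀⟩ := hμ
  refine ⟨x₀, ?_⟩
  have hm : ∀ x₀ : Phase d, Measurable fun x => ENNReal.ofReal (phaseDist x₀ x ^ p) := fun x₀ =>
    ((continuous_phaseDist.comp (Continuous.prodMk_right x₀)).measurable.pow_const p).ennreal_ofReal
  rw [lintegral_map (hm x₀) hS]
  have hle : ∀ x, ENNReal.ofReal (phaseDist x₀ (S x) ^ p) ≤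
      ENNReal.ofReal (2 ^ p) * ENNReal.ofReal (phaseDist x₀ x ^ p) +
        ENNReal.ofReal (2 ^ p * (2 * d) ^ p) := by
    intro x
    have ha := phaseDist_nonneg x₀ x
    rw [← ENNReal.ofReal_mul (by positivity), ← ENNReal.ofReal_add (by positivity) (by positivity)]
    apply ENNReal.ofReal_le_ofReal
    have h1 : phaseDist x₀ (S x) ≤ 2 * max (phaseDist x₀ x) (2 * d) := by
      have h2 := phaseDist_triangle x₀ x (S x)
      have h3 := phaseDist_le_of_snd_eq (hS2 x).symm
      have h4 := le_max_left (phaseDist x₀ x) (2 * d)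
      have h5 := le_max_right (phaseDist x₀ x) (2 * (d : ℝ))
      linarith
    have hmax : 0 ≤ max (phaseDist x₀ x) (2 * (d : ℝ)) := le_max_of_le_left ha
    calc phaseDist x₀ (S x) ^ p ≤ (2 * max (phaseDist x₀ x) (2 * d)) ^ p :=
          Real.rpow_le_rpow (phaseDist_nonneg _ _) h1 (by linarith)
      _ = 2 ^ p * max (phaseDist x₀ x) (2 * d) ^ p := Real.mul_rpow (by norm_num) hmax
      _ ≤ 2 ^ p * (phaseDist x₀ x ^ p + (2 * d) ^ p) := by
          gcongr
          rcases max_cases (phaseDist x₀ x) (2 * (d : ℝ)) with h | h <;> rw [h.1]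
          · have : (0 : ℝ) ≤ (2 * d) ^ p := by positivity
            linarith
          · have : 0 ≤ phaseDist x₀ x ^ p := by positivity
            linarith
      _ = _ := by ring
  refine (lintegral_mono hle).trans_lt ?_
  rw [lintegral_add_right _ measurable_const, lintegral_const_mul _ (hm x₀), lintegral_const]
  exact ENNReal.add_lt_top.2 ⟨ENNReal.mul_lt_top ENNReal.ofReal_lt_top hx₀,
    ENNReal.mul_lt_top ENNReal.ofReal_lt_top (measure_lt_top _ _)⟩

theorem IsFlow.continuous_apply {κ : ℝ} {M : ℝ≥0 → Mat d} {T : ℝ≥0 → Phase d → Phase d}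
    (hT : IsFlow κ M T) (t : ℝ≥0) : Continuous (T t) :=
  hT.continuous.comp (Continuous.prodMk_right t)

/-- The curve `t ↦ (T t)_* f₀` of push-forwards of `f₀` under a flow. -/
noncomputable def IsFlow.push {κ : ℝ} {M : ℝ≥0 → Mat d} {T : ℝ≥0 → Phase d → Phase d}
    (hT : IsFlow κ M T) (f₀ : P1 d) (t : ℝ≥0) : P1 d :=
  ⟨f₀.1.map (hT.continuous_apply t).measurable.aemeasurable,
    f₀.2.map le_rfl (hT.continuous_apply t).measurable (hT.snd t)⟩

theorem IsFlow.toMeasure_push {κ : ℝ} {M : ℝ≥0 → Mat d} {T : ℝ≥0 → Phase d → Phase d}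
    (hT : IsFlow κ M T) (f₀ : P1 d) (t : ℝ≥0) :
    (hT.push f₀ t).1.toMeasure = f₀.1.toMeasure.map (T t) :=
  rfl

theorem IsFlow.push_zero {κ : ℝ} {M : ℝ≥0 → Mat d} {T : ℝ≥0 → Phase d → Phase d}
    (hT : IsFlow κ M T) (f₀ : P1 d) : hT.push f₀ 0 = f₀ := by
  refine Subtype.ext (Subtype.ext ?_)
  change f₀.1.toMeasure.map (T 0) = f₀.1.toMeasure
  rw [show T 0 = id from funext hT.zero, Measure.map_id]

theorem IsFlow.continuousMK1_push {κ : ℝ} {M : ℝ≥0 → Mat d} {T : ℝ≥0 → Phase d → Phase d}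
    (hT : IsFlow κ M T) (f₀ : P1 d) : ContinuousMK1 (hT.push f₀) := by
  intro t
  have hle : ∀ s, distMK1 (hT.push f₀ s).1.toMeasure (hT.push f₀ t).1.toMeasure ≤
      ∫⁻ x, ENNReal.ofReal (phaseDist (T s x) (T t x)) ∂f₀.1.toMeasure := by
    intro s
    have hm : Measurable fun x => (T s x, T t x) :=
      ((hT.continuous_apply s).prodMk (hT.continuous_apply t)).measurable
    have hmem : f₀.1.toMeasure.map (fun x => (T s x, T t x)) ∈
        couplings (hT.push f₀ s).1.toMeasure (hT.push f₀ t).1.toMeasure := by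
      rw [hT.toMeasure_push, hT.toMeasure_push]
      exact ⟨by rw [Measure.fst, Measure.map_map measurable_fst hm]; rfl,
        by rw [Measure.snd, Measure.map_map measurable_snd hm]; rfl⟩
    refine (iInf₂_le _ hmem).trans (le_of_eq ?_)
    exact lintegral_map continuous_phaseDist.measurable.ennreal_ofReal hm
  refine tendsto_of_tendsto_of_tendsto_of_le_of_le tendsto_const_nhds ?_ (fun s => zero_le) hle
  have hlim := tendsto_lintegral_filter_of_dominated_convergence (μ := f₀.1.toMeasure) (l := 𝓝 t)
    (F := fun s x => ENNReal.ofReal (phaseDist (T s x) (T t x))) (f := fun _ => 0)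
    (fun _ => ENNReal.ofReal (2 * d)) (Eventually.of_forall fun s => ?_)
    (Eventually.of_forall fun s => ae_of_all _ fun x => ENNReal.ofReal_le_ofReal ?_) ?_
    (ae_of_all _ fun x => ?_)
  · simpa using hlim
  · exact (continuous_phaseDist.comp
      ((hT.continuous_apply s).prodMk (hT.continuous_apply t))).measurable.ennreal_ofReal
  · exact phaseDist_le_of_snd_eq (by rw [hT.snd, hT.snd])
  · rw [lintegral_const]
    exact ENNReal.mul_ne_top ENNReal.ofReal_ne_top (measure_ne_top _ _)
  · have h1 : Continuous fun s => T s x := hT.continuous.comp (Continuous.prodMk_left x)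
    have h3 := continuous_phaseDist_comp h1 (continuous_const (y := T t x))
    have h4 := (ENNReal.continuous_ofReal.comp h3).tendsto t
    have h0 : phaseDist (T t x) (T t x) = 0 := by simp [phaseDist]
    rw [Function.comp_apply, h0, ENNReal.ofReal_zero] at h4
    exact h4

/-! ### Push-forwards solve the transport equation -/

theorem continuous_drift {X : Type*} [TopologicalSpace X] (κ : ℝ) {m U A : X → Mat d}
    (hm : Continuous m) (hU : Continuous U) (hA : Continuous A) :
    Continuous fun s => drift κ (m s) (U s) (A s) := by
  unfold drift
  exact (hA.mul hU).add
    ((contDiff_coupling.continuous.comp (hm.prodMk hU)).const_smul (κ / 2))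

theorem exists_norm_drift_le (d : ℕ) (κ : ℝ) : ∃ B : ℝ, 0 ≤ B ∧ ∀ (m A : Mat d)
    (U : Matrix.unitaryGroup (Fin d) ℂ), ‖drift κ m U A‖ ≤ ‖A‖ * d + B := by
  obtain ⟨B, hB⟩ := exists_bound_coupling (d := d)
  have hB0 : 0 ≤ B := (norm_nonneg _).trans (hB 0)
  refine ⟨‖κ / 2‖ * B, by positivity, fun m A U => (norm_add_le _ _).trans ?_⟩
  gcongr
  · exact (norm_mul_le _ _).trans (by gcongr; exact norm_coe_unitary_le U)
  · rw [norm_smul]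
    gcongr
    exact hB _

/-- The point `(t, U, A)` of the ambient space of test functions. -/
def ambient (t : ℝ) (x : Phase d) : ℝ × Mat d × Mat d := (t, (x.1 : Mat d), (x.2 : Mat d))

theorem continuous_ambient {X : Type*} [TopologicalSpace X] {t : X → ℝ} {x : X → Phase d}
    (ht : Continuous t) (hx : Continuous x) : Continuous fun s => ambient (t s) (x s) :=
  ht.prodMk ((continuous_coe_fst.comp hx).prodMk (continuous_coe_snd.comp hx))

/-- The weak form of the linear transport equation with a prescribed average `M`. -/
def IsLinearWeakSolution (κ : ℝ) (M : ℝ≥0 → Mat d) (f : ℝ≥0 → P1 d) : Prop :=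
  ∀ φ : ℝ × Mat d × Mat d → ℝ, IsTestFunction φ →
    ∫ t in Ioi (0 : ℝ), ∫ x : Phase d, fderiv ℝ φ (ambient t x)
      (1, drift κ (M t.toNNReal) x.1 x.2, 0) ∂((f t.toNNReal).1.toMeasure) = 0

theorem deriv_add_fderiv_eq {φ : ℝ × Mat d × Mat d → ℝ} (hφ : Differentiable ℝ φ) (t : ℝ)
    (x : Phase d) (v : Mat d) :
    deriv (fun s : ℝ => φ (s, (x.1 : Mat d), (x.2 : Mat d))) t
        + fderiv ℝ (fun W : Mat d => φ (t, W, (x.2 : Mat d))) (x.1 : Mat d) v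
      = fderiv ℝ φ (ambient t x) (1, v, 0) := by
  have h := (hφ (ambient t x)).hasFDerivAt
  have h1 : HasDerivAt (fun s : ℝ => φ (s, (x.1 : Mat d), (x.2 : Mat d)))
      (fderiv ℝ φ (ambient t x) (1, 0, 0)) t :=
    HasFDerivAt.comp_hasDerivAt (f := fun s : ℝ => (s, (x.1 : Mat d), (x.2 : Mat d))) t h
      ((hasDerivAt_id t).prodMk (hasDerivAt_const t ((x.1 : Mat d), (x.2 : Mat d))))
  have h2 : HasFDerivAt (fun W : Mat d => φ (t, W, (x.2 : Mat d)))
      ((fderiv ℝ φ (ambient t x)).comp ((0 : Mat d →L[ℝ] ℝ).prod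
        ((ContinuousLinearMap.id ℝ (Mat d)).prod (0 : Mat d →L[ℝ] Mat d)))) (x.1 : Mat d) :=
    HasFDerivAt.comp (f := fun W : Mat d => (t, W, (x.2 : Mat d))) _ h
      ((hasFDerivAt_const t _).prodMk ((hasFDerivAt_id _).prodMk (hasFDerivAt_const _ _)))
  rw [h1.deriv, h2.fderiv, ContinuousLinearMap.comp_apply, ← map_add]
  congr 1
  simp

theorem isWeakSolution_iff {κ : ℝ} {f : ℝ≥0 → P1 d} :
    IsWeakSolution κ f ↔ IsLinearWeakSolution κ (fun t => mean (f t).1.toMeasure) f := by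
  refine forall₂_congr fun φ hφ => ?_
  have hd : Differentiable ℝ φ := hφ.smooth.differentiable (by simp)
  simp only [deriv_add_fderiv_eq hd, field_eq_drift]

theorem IsTestFunction.exists_time_bound {φ : ℝ × Mat d × Mat d → ℝ} (hφ : IsTestFunction φ) :
    ∃ τ : ℝ, ∀ z, z.1 ∉ Ioc 0 τ → z ∉ tsupport φ := by
  obtain ⟨τ, hτ⟩ := (hφ.compact.isCompact.image continuous_fst).bddAbove
  refine ⟨τ, fun z hz hmem => hz ⟨(hφ.pos_time hmem).1, hτ (mem_image_of_mem _ hmem)⟩⟩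

/-- The integrand of the weak form is bounded, although the drift is not: the derivative of the test
function has compact support. -/
theorem IsTestFunction.exists_bound {φ : ℝ × Mat d × Mat d → ℝ} (hφ : IsTestFunction φ) (κ : ℝ) :
    ∃ C : ℝ, ∀ t x m, ‖fderiv ℝ φ (ambient t x) (1, drift κ m x.1 x.2, 0)‖ ≤ C := by
  obtain ⟨B, hB0, hB⟩ := exists_norm_drift_le d κ
  have hcont : Continuous (fderiv ℝ φ) := hφ.smooth.continuous_fderiv (by simp)
  have hsupp : HasCompactSupport fun z => ‖fderiv ℝ φ z‖ * (1 + (‖z‖ * d + B)) :=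
    (hφ.compact.fderiv ℝ).norm.mul_right
  obtain ⟨C, hC⟩ := hsupp.exists_bound_of_continuous (by fun_prop)
  refine ⟨C, fun t x m => ?_⟩
  refine le_trans ?_ ((Real.le_norm_self _).trans (hC (ambient t x)))
  refine (ContinuousLinearMap.le_opNorm _ _).trans ?_
  gcongr
  have hA : ‖(x.2 : Mat d)‖ ≤ ‖ambient t x‖ :=
    (norm_snd_le (ambient t x).2).trans (norm_snd_le (ambient t x))
  have hv : ‖drift κ m x.1 x.2‖ ≤ ‖ambient t x‖ * d + B := by
    refine (hB m x.2 x.1).trans ?_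
    gcongr
  have h0 := (norm_nonneg _).trans hv
  refine max_le ?_ (max_le ?_ ?_)
  · simpa using h0
  · exact hv.trans (by linarith)
  · rw [norm_zero]; linarith

/-- The push-forward of any measure under the flow is transported by the flow's velocity field. -/
theorem IsFlow.isLinearWeakSolution_push {κ : ℝ} {M : ℝ≥0 → Mat d} {T : ℝ≥0 → Phase d → Phase d}
    (hT : IsFlow κ M T) (hM : Continuous M) (f₀ : P1 d) :
    IsLinearWeakSolution κ M (hT.push f₀) := by
  intro φ hφ
  obtain ⟨τ, hτ⟩ := hφ.exists_time_bound
  obtain ⟨C, hC⟩ := hφ.exists_bound κ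
  have hcont : Continuous (fderiv ℝ φ) := hφ.smooth.continuous_fderiv (by simp)
  have hTc : Continuous fun p : ℝ × Phase d => T p.1.toNNReal p.2 :=
    hT.continuous.comp (f := fun p : ℝ × Phase d => (p.1.toNNReal, p.2)) (by fun_prop)
  let H : ℝ → Phase d → ℝ := fun t x => fderiv ℝ φ (ambient t (T t.toNNReal x))
    (1, drift κ (M t.toNNReal) (T t.toNNReal x).1 (T t.toNNReal x).2, 0)
  have hH : Continuous (Function.uncurry H) := by
    have h1 := continuous_ambient continuous_fst hTc
    have h2 := continuous_drift κ (hM.comp (continuous_real_toNNReal.comp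
      (continuous_fst (X := ℝ) (Y := Phase d)))) (continuous_coe_fst.comp hTc)
      (continuous_coe_snd.comp hTc)
    exact (hcont.comp h1).clm_apply (continuous_const.prodMk (h2.prodMk continuous_const))
  have hbd : ∀ t x, ‖H t x‖ ≤ (Ioc 0 τ).indicator (fun _ => C) t := by
    intro t x
    by_cases ht : t ∈ Ioc 0 τ
    · rw [indicator_of_mem ht]
      exact hC _ _ _
    · rw [indicator_of_notMem ht]
      have : fderiv ℝ φ (ambient t (T t.toNNReal x)) = 0 := by
        by_contra hne
        exact hτ (ambient t (T t.toNNReal x)) ht (support_fderiv_subset ℝ hne)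
      simp [H, this]
  have hind : Integrable ((Ioc 0 τ).indicator (fun _ => C)) (volume.restrict (Ioi (0 : ℝ))) :=
    ((integrable_indicator_iff measurableSet_Ioc).2 (integrableOn_const (by simp))).restrict
  have hint : Integrable (Function.uncurry H)
      ((volume.restrict (Ioi (0 : ℝ))).prod f₀.1.toMeasure) :=
    (hind.comp_fst f₀.1.toMeasure).mono' hH.aestronglyMeasurable
      (ae_of_all _ fun p => hbd p.1 p.2)
  have hpush : ∀ t : ℝ, ∫ x : Phase d, fderiv ℝ φ (ambient t x)
      (1, drift κ (M t.toNNReal) x.1 x.2, 0) ∂((hT.push f₀ t.toNNReal).1.toMeasure)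
      = ∫ x, H t x ∂f₀.1.toMeasure := by
    intro t
    rw [hT.toMeasure_push, integral_map (hT.continuous_apply _).measurable.aemeasurable]
    have h1 := continuous_ambient (continuous_const (y := t)) (continuous_id (X := Phase d))
    have h2 := continuous_drift κ (continuous_const (y := M t.toNNReal)) continuous_coe_fst
      continuous_coe_snd
    exact ((hcont.comp h1).clm_apply
      (continuous_const.prodMk (h2.prodMk continuous_const))).aestronglyMeasurable
  simp only [hpush]
  rw [integral_integral_swap hint]
  have hzero : ∀ x, ∫ t in Ioi (0 : ℝ), H t x = 0 := by
    intro x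
    have hlim : Tendsto (fun t : ℝ => φ (ambient t (T t.toNNReal x))) atTop (𝓝 0) := by
      refine tendsto_const_nhds.congr' ?_
      filter_upwards [eventually_gt_atTop τ] with t ht
      exact (image_eq_zero_of_notMem_tsupport (hτ _ fun h => (not_le.2 ht) h.2)).symm
    have hxc : Continuous fun t : ℝ => T t.toNNReal x := hTc.comp (Continuous.prodMk_left x)
    have hder : ∀ t ∈ Ioi (0 : ℝ),
        HasDerivAt (fun t : ℝ => φ (ambient t (T t.toNNReal x))) (H t x) t := by
      intro t ht
      have hd := (hφ.smooth.differentiable (by simp) (ambient t (T t.toNNReal x))).hasFDerivAt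
      have hsnd : HasDerivAt (fun t : ℝ => ((T t.toNNReal x).2 : Mat d)) 0 t := by
        simp only [hT.snd]
        exact hasDerivAt_const t _
      have hc : HasDerivAt (fun t : ℝ => ambient t (T t.toNNReal x))
          (1, drift κ (M t.toNNReal) (T t.toNNReal x).1 (T t.toNNReal x).2, 0) t :=
        (hasDerivAt_id t).prodMk ((hT.hasDerivAt hM x ht).prodMk hsnd)
      exact hd.comp_hasDerivAt t hc
    have hint' : IntegrableOn (fun t => H t x) (Ioi 0) :=
      hind.mono' (hH.comp (Continuous.prodMk_left x)).aestronglyMeasurable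
        (ae_of_all _ fun t => hbd t x)
    have h0 : φ (ambient 0 (T (0 : ℝ).toNNReal x)) = 0 :=
      image_eq_zero_of_notMem_tsupport (hτ _ fun h => lt_irrefl (0 : ℝ) h.1)
    refine (integral_Ioi_of_hasDerivAt_of_tendsto
      (hφ.smooth.continuous.comp (continuous_ambient continuous_id hxc)).continuousWithinAt
      hder hint' hlim).trans ?_
    change 0 - φ (ambient 0 (T (0 : ℝ).toNNReal x)) = 0
    rw [h0, sub_zero]
  simp [hzero]

/-! ### Weak derivatives in time -/

/-- A continuous function whose distributional derivative on `(0,∞)` vanishes is constant on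
`[0,∞)`: its regularizations are constant. -/
theorem eq_of_integral_deriv_mul_eq_zero {b : ℝ → ℝ} (hb : Continuous b)
    (h : ∀ η : ℝ → ℝ, ContDiff ℝ ∞ η → HasCompactSupport η → tsupport η ⊆ Ioi 0 →
      ∫ r, deriv η r * b r = 0) {t : ℝ} (ht : 0 ≤ t) : b t = b 0 := by
  have key : ∀ s t, 0 < s → s ≤ t → b t = b s := by
    intro s t hs hst
    refine eq_of_forall_dist_le fun ε hε => ?_
    obtain ⟨δ₁, hδ₁, h₁⟩ := Metric.continuous_iff.1 hb s (ε / 2) (half_pos hε)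
    obtain ⟨δ₂, hδ₂, h₂⟩ := Metric.continuous_iff.1 hb t (ε / 2) (half_pos hε)
    obtain ⟨δ, hδ, hlt⟩ : ∃ δ, 0 < δ ∧ δ < min s (min δ₁ δ₂) :=
      exists_between (lt_min hs (lt_min hδ₁ hδ₂))
    have hlt1 : δ < s := hlt.trans_le (min_le_left _ _)
    have hlt2 : δ < δ₁ := hlt.trans_le ((min_le_right _ _).trans (min_le_left _ _))
    have hlt3 : δ < δ₂ := hlt.trans_le ((min_le_right _ _).trans (min_le_right _ _))
    let ρ : ContDiffBump (0 : ℝ) := ⟨δ / 2, δ, by positivity, by linarith⟩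
    let F := convolution (ρ.normed volume) b (ContinuousLinearMap.lsmul ℝ ℝ) volume
    have hρs : HasCompactSupport (ρ.normed volume) := ρ.hasCompactSupport_normed
    have hρ : ContDiff ℝ ∞ (ρ.normed volume) := ρ.contDiff_normed
    have hF : ∀ r, δ < r → HasDerivAt F 0 r := by
      intro r hr
      have h1 := hρs.hasDerivAt_convolution_left (ContinuousLinearMap.lsmul ℝ ℝ)
        (μ := volume) (hρ.of_le (by simp)) hb.locallyIntegrable r
      refine h1.congr_deriv ?_
      rw [convolution_eq_swap]
      have hη := h (fun y => ρ.normed volume (r - y)) (by fun_prop)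
        (hρs.comp_homeomorph (Homeomorph.subLeft r)) ?_
      · have hd : ∀ y, deriv (fun y => ρ.normed volume (r - y)) y
            = -deriv (ρ.normed volume) (r - y) := fun y => deriv_comp_const_sub _ _ _
        simp only [hd, neg_mul, integral_neg, neg_eq_zero] at hη
        simpa using hη
      · refine (tsupport_comp_subset_preimage (ρ.normed volume)
          (f := fun y => r - y) (by fun_prop)).trans fun y hy => ?_
        rw [mem_preimage, ρ.tsupport_normed_eq, Real.closedBall_eq_Icc] at hy
        have : r - y ≤ 0 + δ := hy.2
        rw [mem_Ioi]
        linarith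
    have hFc := constant_of_has_deriv_right_zero (f := F) (a := s) (b := t)
      (fun r hr => (hF r (hlt1.trans_le hr.1)).continuousAt.continuousWithinAt)
      (fun r hr => (hF r (hlt1.trans_le hr.1)).hasDerivWithinAt) t ⟨hst, le_rfl⟩
    have hs' : dist (F s) (b s) ≤ ε / 2 := ρ.dist_normed_convolution_le hb.aestronglyMeasurable
      fun y hy => (h₁ y ((Metric.mem_ball.1 hy).trans hlt2)).le
    have ht' : dist (F t) (b t) ≤ ε / 2 := ρ.dist_normed_convolution_le hb.aestronglyMeasurable
      fun y hy => (h₂ y ((Metric.mem_ball.1 hy).trans hlt3)).le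
    rw [hFc] at ht'
    calc dist (b t) (b s) ≤ dist (b t) (F s) + dist (F s) (b s) := dist_triangle _ _ _
      _ ≤ ε / 2 + ε / 2 := by
          rw [dist_comm (b t)]
          exact add_le_add ht' hs'
      _ = ε := by ring
  have heq : EqOn b (fun _ => b 1) (Ioi 0) := fun s hs => by
    rcases le_total s 1 with h1 | h1
    · exact (key s 1 hs h1).symm
    · exact key 1 s one_pos h1
  have := heq.closure hb continuous_const
  rw [closure_Ioi] at this
  rw [this ht, this self_mem_Ici]

/-- If `a' = c` holds in the sense of distributions on `(0,∞)`, for continuous functions, then the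
fundamental theorem of calculus holds up to `t = 0`. -/
theorem sub_eq_integral_of_weak_deriv {a c : ℝ → ℝ} (ha : Continuous a) (hc : Continuous c)
    (h : ∀ η : ℝ → ℝ, ContDiff ℝ ∞ η → HasCompactSupport η → tsupport η ⊆ Ioi 0 →
      ∫ r in Ioi (0 : ℝ), (deriv η r * a r + η r * c r) = 0) {s t : ℝ} (hs : 0 ≤ s) (ht : 0 ≤ t) :
    a t - a s = ∫ r in s..t, c r := by
  let v : ℝ → ℝ := fun r => ∫ u in (0 : ℝ)..r, c u
  have hv : ∀ r, HasDerivAt v (c r) r := fun r => hc.integral_hasStrictDerivAt 0 r |>.hasDerivAt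
  have hvc : Continuous v := continuous_iff_continuousAt.2 fun r => (hv r).continuousAt
  have key : ∀ r, 0 ≤ r → a r - v r = a 0 - v 0 := by
    intro r hr
    refine eq_of_integral_deriv_mul_eq_zero (b := fun r => a r - v r) (ha.sub hvc) ?_ hr
    intro η hη hηs hη0
    have hη' : Continuous (deriv η) := hη.continuous_deriv (by simp)
    have i1 : Integrable fun r => deriv η r * a r :=
      (hη'.mul ha).integrable_of_hasCompactSupport hηs.deriv.mul_right
    have i2 : Integrable fun r => η r * c r :=
      (hη.continuous.mul hc).integrable_of_hasCompactSupport hηs.mul_right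
    have i3 : Integrable fun r => deriv η r * v r :=
      (hη'.mul hvc).integrable_of_hasCompactSupport hηs.deriv.mul_right
    have i4 : Integrable fun r => η r * v r :=
      (hη.continuous.mul hvc).integrable_of_hasCompactSupport hηs.mul_right
    have hparts := integral_mul_deriv_eq_deriv_mul_of_integrable
      (fun r _ => (hη.differentiable (by simp) r).hasDerivAt) (fun r _ => hv r) i2 i3 i4
    have h0 := h η hη hηs hη0
    rw [setIntegral_eq_integral_of_forall_compl_eq_zero, integral_add i1 i2] at h0
    · simp only [mul_sub]
      rw [integral_sub i1 i3]
      linarith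
    · intro r hr
      have h1 : r ∉ tsupport η := fun hmem => hr (hη0 hmem)
      have h2 : deriv η r = 0 := by
        by_contra hne
        exact h1 (support_deriv_subset hne)
      rw [h2, image_eq_zero_of_notMem_tsupport h1]
      simp
  have h1 := key s hs
  have h2 := key t ht
  have h3 : v t - v s = ∫ r in s..t, c r :=
    intervalIntegral.integral_interval_sub_left (hc.intervalIntegrable _ _)
      (hc.intervalIntegrable _ _)
  linarith

/-! ### Evolution of integrals along a weak solution -/

/-- The image of a point of the phase space in `M_d(ℂ) × M_d(ℂ)`. -/
def coords (x : Phase d) : Mat d × Mat d := ((x.1 : Mat d), (x.2 : Mat d))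

theorem continuous_coords : Continuous (coords (d := d)) :=
  continuous_coe_fst.prodMk continuous_coe_snd

theorem norm_coords_sub_le (x y : Phase d) : ‖coords x - coords y‖ ≤ phaseDist x y := by
  unfold phaseDist coords
  refine max_le ?_ ?_
  · exact le_add_of_nonneg_right (norm_nonneg _)
  · exact le_add_of_nonneg_left (norm_nonneg _)

theorem contDiff_drift (κ : ℝ) :
    ContDiff ℝ ∞ fun q : Mat d × Mat d × Mat d => drift κ q.1 q.2.1 q.2.2 := by
  unfold drift
  have h1 : ContDiff ℝ ∞ fun q : Mat d × Mat d × Mat d => q.2.2 * q.2.1 :=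
    contDiff_snd.snd.mul contDiff_snd.fst
  exact h1.add ((contDiff_coupling.comp
    (contDiff_fst.prodMk contDiff_snd.fst)).const_smul (κ / 2))

theorem contDiff_fderiv_drift (κ : ℝ) {ψ : Mat d × Mat d → ℝ} (hψ : ContDiff ℝ ∞ ψ) :
    ContDiff ℝ ∞ fun q : Mat d × Mat d × Mat d =>
      fderiv ℝ ψ q.2 (drift κ q.1 q.2.1 q.2.2, 0) := by
  have h1 : ContDiff ℝ ∞ fun q : Mat d × Mat d × Mat d => fderiv ℝ ψ q.2 :=
    (hψ.fderiv_right (m := ∞) (by simp)).comp contDiff_snd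
  exact h1.clm_apply ((contDiff_drift κ).prodMk contDiff_const)

/-- The weak form tested on `η(t) ψ(U, A)`. -/
theorem integral_testFunction_eq_zero {κ : ℝ} {M : ℝ≥0 → Mat d} {f : ℝ≥0 → P1 d}
    (hf : IsLinearWeakSolution κ M f) {ψ : Mat d × Mat d → ℝ} (hψ : ContDiff ℝ ∞ ψ)
    (hψs : HasCompactSupport ψ) {η : ℝ → ℝ} (hη : ContDiff ℝ ∞ η) (hηs : HasCompactSupport η)
    (hη0 : tsupport η ⊆ Ioi 0) :
    ∫ t in Ioi (0 : ℝ), ∫ x : Phase d, (deriv η t * ψ (coords x) +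
      η t * fderiv ℝ ψ (coords x) (drift κ (M t.toNNReal) x.1 x.2, (0 : Mat d)))
        ∂((f t.toNNReal).1.toMeasure) = 0 := by
  let φ : ℝ × Mat d × Mat d → ℝ := fun z => η z.1 * ψ z.2
  have hsub : tsupport φ ⊆ tsupport η ×ˢ tsupport ψ := by
    refine closure_minimal (fun z hz => ?_) ((isClosed_tsupport η).prod (isClosed_tsupport ψ))
    have hz' : η z.1 * ψ z.2 ≠ 0 := hz
    exact ⟨subset_tsupport _ (left_ne_zero_of_mul hz'), subset_tsupport _ (right_ne_zero_of_mul hz')⟩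
  have hφ : IsTestFunction φ :=
    { smooth := (hη.comp contDiff_fst).mul (hψ.comp contDiff_snd)
      compact := (hηs.isCompact.prod hψs.isCompact).of_isClosed_subset (isClosed_tsupport φ) hsub
      pos_time := fun z hz => ⟨hη0 (hsub hz).1, mem_univ _⟩ }
  refine Eq.trans ?_ (hf φ hφ)
  refine integral_congr_ae (ae_of_all _ fun t => integral_congr_ae (ae_of_all _ fun x => ?_))
  have h1 := ((hη.differentiable (by simp) t).hasDerivAt.hasFDerivAt).comp (ambient t x)
    (hasFDerivAt_fst (𝕜 := ℝ) (E := ℝ) (F := Mat d × Mat d))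
  have h2 := ((hψ.differentiable (by simp) (coords x)).hasFDerivAt).comp (ambient t x)
    (hasFDerivAt_snd (𝕜 := ℝ) (E := ℝ) (F := Mat d × Mat d))
  have h3 : fderiv ℝ φ (ambient t x) = _ := (h1.mul h2).fderiv
  refine Eq.trans ?_ (DFunLike.congr_fun h3 _).symm
  simp [ambient, coords]
  ring

/-- The evolution of `∫ ψ df(t)` for compactly supported `ψ`. -/
theorem integral_sub_integral_eq_of_hasCompactSupport {κ : ℝ} {M : ℝ≥0 → Mat d}
    {f : ℝ≥0 → P1 d} (hM : Continuous M) (hMd : ∀ t, ‖M t‖ ≤ d) (hfc : ContinuousMK1 f)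
    (hf : IsLinearWeakSolution κ M f) {ψ : Mat d × Mat d → ℝ} (hψ : ContDiff ℝ ∞ ψ)
    (hψs : HasCompactSupport ψ) :
    (Continuous fun t => ∫ x, fderiv ℝ ψ (coords x) (drift κ (M t) x.1 x.2, 0)
      ∂(f t).1.toMeasure) ∧
    ∀ s t : ℝ, 0 ≤ s → 0 ≤ t →
    ∫ x, ψ (coords x) ∂(f t.toNNReal).1.toMeasure - ∫ x, ψ (coords x) ∂(f s.toNNReal).1.toMeasure
      = ∫ r in s..t, ∫ x, fderiv ℝ ψ (coords x) (drift κ (M r.toNNReal) x.1 x.2, (0 : Mat d))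
          ∂(f r.toNNReal).1.toMeasure := by
  have : ProperSpace (Mat d) := FiniteDimensional.proper ℝ (Mat d)
  obtain ⟨L, hL⟩ := ContDiff.lipschitzWith_of_hasCompactSupport hψs hψ (by simp)
  obtain ⟨B, hB⟩ := hψs.exists_bound_of_continuous hψ.continuous
  have hψi : ∀ t, Integrable (fun x => ψ (coords x)) (f t).1.toMeasure := fun t =>
    .of_bound (hψ.continuous.comp continuous_coords).aestronglyMeasurable B
      (ae_of_all _ fun x => hB _)
  have ha : Continuous fun t => ∫ x, ψ (coords x) ∂(f t).1.toMeasure := by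
    refine hfc.continuous_integral (M := fun _ => (0 : ℝ)) (L := L) continuous_const
      (fun _ t => hψi t) (fun t x y => ?_) (fun s t x => by simp)
    refine (hL.norm_sub_le _ _).trans ?_
    gcongr
    exact norm_coords_sub_le x y
  -- The cutoff in `m` is invisible along `M` and makes the integrand compactly supported.
  let G : Mat d × Mat d × Mat d → ℝ := fun q =>
    cutoff d q.1 * fderiv ℝ ψ q.2 (drift κ q.1 q.2.1 q.2.2, 0)
  have hG : ContDiff ℝ ∞ G := ((cutoff d).contDiff.comp contDiff_fst).mul
    (contDiff_fderiv_drift κ hψ)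
  have hGs : HasCompactSupport G := by
    refine HasCompactSupport.intro ((cutoff d).hasCompactSupport.isCompact.prod hψs.isCompact)
      fun q hq => ?_
    rw [mem_prod, not_and_or] at hq
    rcases hq with hq | hq
    · simp only [G, image_eq_zero_of_notMem_tsupport hq, zero_mul]
    · have : fderiv ℝ ψ q.2 = 0 := by
        by_contra hne
        exact hq (support_fderiv_subset ℝ hne)
      simp [G, this]
  obtain ⟨L', hL'⟩ := ContDiff.lipschitzWith_of_hasCompactSupport hGs hG (by simp)
  obtain ⟨B', hB'⟩ := hGs.exists_bound_of_continuous hG.continuous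
  have hGM : ∀ t x, fderiv ℝ ψ (coords x) (drift κ (M t) x.1 x.2, 0) = G (M t, coords x) := by
    intro t x
    simp only [G, cutoff_eq_one (hMd t), one_mul]
    rfl
  have hc : Continuous fun t => ∫ x, fderiv ℝ ψ (coords x) (drift κ (M t) x.1 x.2, 0)
      ∂(f t).1.toMeasure := by
    simp only [hGM]
    refine hfc.continuous_integral (Z := fun t x => G (M t, coords x)) hM (L := L')
      (fun s t => ?_) (fun t x y => ?_) (fun s t x => ?_)
    · refine .of_bound (Continuous.aestronglyMeasurable ?_) B' (ae_of_all _ fun x => hB' _)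
      exact hG.continuous.comp (continuous_const.prodMk continuous_coords)
    · refine (hL'.norm_sub_le _ _).trans ?_
      gcongr
      rw [Prod.mk_sub_mk, sub_self, Prod.norm_mk, norm_zero, max_eq_right (norm_nonneg _)]
      exact norm_coords_sub_le x y
    · refine (hL'.norm_sub_le _ _).trans ?_
      rw [Prod.mk_sub_mk, sub_self, Prod.norm_mk, norm_zero, max_eq_left (norm_nonneg _)]
  refine ⟨hc, fun s t hs ht => ?_⟩
  refine sub_eq_integral_of_weak_deriv (ha.comp continuous_real_toNNReal)
    (hc.comp continuous_real_toNNReal) ?_ hs ht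
  intro η hη hηs hη0
  refine Eq.trans ?_ (integral_testFunction_eq_zero hf hψ hψs hη hηs hη0)
  refine integral_congr_ae (ae_of_all _ fun r => ?_)
  have hci : Integrable (fun x => fderiv ℝ ψ (coords x) (drift κ (M r.toNNReal) x.1 x.2, (0 : Mat d)))
      (f r.toNNReal).1.toMeasure := by
    simp only [hGM]
    refine .of_bound (Continuous.aestronglyMeasurable ?_) B' (ae_of_all _ fun x => hB' _)
    exact hG.continuous.comp (continuous_const.prodMk continuous_coords)
  simp only [Function.comp_apply]
  rw [integral_add ((hψi _).const_mul _) (hci.const_mul _), integral_const_mul, integral_const_mul]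

/-- Functions on `M_d(ℂ) × M_d(ℂ)` whose support is bounded in the `A` direction. -/
def VanishesBeyond (R : ℝ) (ψ : Mat d × Mat d → ℝ) : Prop := ∀ U A, R < ‖A‖ → ψ (U, A) = 0

/-- The evolution of `∫ ψ df(t)` when the support of `ψ` is bounded in the `A` direction only: the
unitary group is compact. -/
theorem integral_sub_integral_eq {κ : ℝ} {M : ℝ≥0 → Mat d}
    {f : ℝ≥0 → P1 d} (hM : Continuous M) (hMd : ∀ t, ‖M t‖ ≤ d) (hfc : ContinuousMK1 f)
    (hf : IsLinearWeakSolution κ M f) {ψ : Mat d × Mat d → ℝ} (hψ : ContDiff ℝ ∞ ψ) {R : ℝ}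
    (hR : VanishesBeyond R ψ) :
    (Continuous fun t => ∫ x, fderiv ℝ ψ (coords x) (drift κ (M t) x.1 x.2, 0)
      ∂(f t).1.toMeasure) ∧
    ∀ s t : ℝ, 0 ≤ s → 0 ≤ t →
    ∫ x, ψ (coords x) ∂(f t.toNNReal).1.toMeasure - ∫ x, ψ (coords x) ∂(f s.toNNReal).1.toMeasure
      = ∫ r in s..t, ∫ x, fderiv ℝ ψ (coords x) (drift κ (M r.toNNReal) x.1 x.2, (0 : Mat d))
          ∂(f r.toNNReal).1.toMeasure := by
  have : ProperSpace (Mat d) := FiniteDimensional.proper ℝ (Mat d)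
  let ψ' : Mat d × Mat d → ℝ := fun z => cutoff d z.1 * ψ z
  have hψ' : ContDiff ℝ ∞ ψ' := ((cutoff d).contDiff.comp contDiff_fst).mul hψ
  -- The support of `ψ'` is bounded in both variables, and `ψ'` agrees with `ψ` near `U(d)`.
  have hs : HasCompactSupport ψ' := by
    refine HasCompactSupport.intro ((cutoff d).hasCompactSupport.isCompact.prod
      (isCompact_closedBall (0 : Mat d) R)) fun z hz => ?_
    rw [mem_prod, not_and_or, mem_closedBall_zero_iff, not_le] at hz
    rcases hz with hz | hz
    · simp only [ψ', image_eq_zero_of_notMem_tsupport hz, zero_mul]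
    · simp only [ψ', hR z.1 z.2 hz, mul_zero]
  have heq : ∀ x : Phase d, ψ' =ᶠ[𝓝 (coords x)] ψ := by
    intro x
    have h1 : Tendsto Prod.fst (𝓝 (coords x)) (𝓝 (x.1 : Mat d)) := continuous_fst.tendsto _
    filter_upwards [h1 (cutoff_eventuallyEq_one (norm_coe_unitary_le x.1))] with z hz
    have hz' : cutoff d z.1 = 1 := hz
    simp only [ψ', hz', one_mul]
  have h := integral_sub_integral_eq_of_hasCompactSupport hM hMd hfc hf hψ' hs
  have h1 : ∀ x : Phase d, fderiv ℝ ψ' (coords x) = fderiv ℝ ψ (coords x) :=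
    fun x => (heq x).fderiv_eq
  have h2 : ∀ x : Phase d, ψ' (coords x) = ψ (coords x) := fun x => (heq x).eq_of_nhds
  simpa only [h1, h2] using h

/-! ### `C^{1,1}` bounds under Euler steps -/

/-- A function of `(U, A)` which is bounded by `a`, with its `U`-derivative bounded by `a` and
`a`-Lipschitz in `U`, uniformly in `A`. -/
structure HasC11Bound {V W : Type*} [NormedAddCommGroup V] [NormedSpace ℝ V] (a : ℝ)
    (φ : V × W → ℝ) : Prop where
  value : ∀ z, |φ z| ≤ a
  deriv : ∀ A U, ‖fderiv ℝ (fun U => φ (U, A)) U‖ ≤ a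
  lip : ∀ A U V, ‖fderiv ℝ (fun U => φ (U, A)) U - fderiv ℝ (fun U => φ (U, A)) V‖ ≤ a * ‖U - V‖

theorem norm_sub_sub_fderiv_le {V G : Type*} [NormedAddCommGroup V] [NormedSpace ℝ V]
    [NormedAddCommGroup G] [NormedSpace ℝ G] {g : V → G}
    (hg : Differentiable ℝ g) {l : ℝ} (hl : 0 ≤ l)
    (hlip : ∀ U W, ‖fderiv ℝ g U - fderiv ℝ g W‖ ≤ l * ‖U - W‖) (U v : V) :
    ‖g (U + v) - g U - fderiv ℝ g U v‖ ≤ l * ‖v‖ ^ 2 := by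
  have h := Convex.norm_image_sub_le_of_norm_fderiv_le' (𝕜 := ℝ) (f := g) (s := segment ℝ U (U + v))
    (C := l * ‖v‖) (φ := fderiv ℝ g U) (x := U) (y := U + v) (fun z _ => hg z) (fun z hz => ?_)
    (convex_segment _ _) (left_mem_segment ℝ _ _) (right_mem_segment ℝ _ _)
  · simpa [sq, mul_assoc] using h
  · refine (hlip z U).trans ?_
    gcongr
    have := norm_sub_le_of_mem_segment hz
    simpa using this

/-- Composition with the Euler step `U ↦ U + h w(U)` increases `C^{1,1}` bounds by a factor
`1 + O(h)`. -/
theorem fderiv_comp_euler_bounds {V : Type*} [NormedAddCommGroup V] [NormedSpace ℝ V] {g : V → ℝ}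
    {w : V → V} (hg : Differentiable ℝ g) (hw : Differentiable ℝ w)
    (hg1 : ∀ U, ‖fderiv ℝ g U‖ ≤ 1)
    (hg2 : ∀ U W, ‖fderiv ℝ g U - fderiv ℝ g W‖ ≤ 1 * ‖U - W‖) {C : ℝ}
    (hw1 : ∀ U, ‖fderiv ℝ w U‖ ≤ C)
    (hw2 : ∀ U W, ‖fderiv ℝ w U - fderiv ℝ w W‖ ≤ C * ‖U - W‖) {h : ℝ} (h0 : 0 ≤ h) (h1 : h ≤ 1) :
    (∀ U, ‖fderiv ℝ (fun U => g (U + h • w U)) U‖ ≤ 1 + h * (3 * C + C ^ 2)) ∧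
    ∀ U W, ‖fderiv ℝ (fun U => g (U + h • w U)) U - fderiv ℝ (fun U => g (U + h • w U)) W‖
      ≤ (1 + h * (3 * C + C ^ 2)) * ‖U - W‖ := by
  have hC : 0 ≤ C := (norm_nonneg _).trans (hw1 0)
  let E : V → V := fun U => U + h • w U
  let J : V → V →L[ℝ] V := fun U => ContinuousLinearMap.id ℝ V + h • fderiv ℝ w U
  have hE : ∀ U, HasFDerivAt E (J U) U := fun U =>
    (hasFDerivAt_id U).add ((hw U).hasFDerivAt.const_smul h)
  have hd : ∀ U, fderiv ℝ (fun U => g (U + h • w U)) U = (fderiv ℝ g (E U)).comp (J U) :=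
    fun U => ((hg (E U)).hasFDerivAt.comp U (hE U)).fderiv
  have hJ : ∀ U, ‖J U‖ ≤ 1 + h * C := fun U => by
    refine (norm_add_le _ _).trans (add_le_add ContinuousLinearMap.norm_id_le ?_)
    rw [norm_smul, Real.norm_of_nonneg h0]
    gcongr
    exact hw1 U
  have hEl : ∀ U W, ‖E U - E W‖ ≤ (1 + h * C) * ‖U - W‖ := fun U W =>
    Convex.norm_image_sub_le_of_norm_hasFDerivWithin_le (𝕜 := ℝ) (s := univ)
      (fun z _ => (hE z).hasFDerivWithinAt) (fun z _ => hJ z) convex_univ (mem_univ _) (mem_univ _)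
  have hhC : 0 ≤ h * C := by positivity
  have hh2 : h * h * C ^ 2 ≤ h * 1 * C ^ 2 := by gcongr
  refine ⟨fun U => ?_, fun U W => ?_⟩
  · rw [hd]
    refine (ContinuousLinearMap.opNorm_comp_le _ _).trans ?_
    calc ‖fderiv ℝ g (E U)‖ * ‖J U‖ ≤ 1 * (1 + h * C) := by
          gcongr
          · exact hg1 _
          · exact hJ U
      _ ≤ _ := by nlinarith [sq_nonneg C]
  · rw [hd, hd]
    have hsplit : (fderiv ℝ g (E U)).comp (J U) - (fderiv ℝ g (E W)).comp (J W)
        = (fderiv ℝ g (E U) - fderiv ℝ g (E W)).comp (J U)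
          + (fderiv ℝ g (E W)).comp (J U - J W) := by
      ext z
      simp
    have hJl : ‖J U - J W‖ ≤ h * (C * ‖U - W‖) := by
      have : J U - J W = h • (fderiv ℝ w U - fderiv ℝ w W) := by
        simp only [J, smul_sub]
        abel
      rw [this, norm_smul, Real.norm_of_nonneg h0]
      gcongr
      exact hw2 U W
    rw [hsplit]
    calc _ ≤ ‖fderiv ℝ g (E U) - fderiv ℝ g (E W)‖ * ‖J U‖ + ‖fderiv ℝ g (E W)‖ * ‖J U - J W‖ :=
          (norm_add_le _ _).trans (add_le_add (ContinuousLinearMap.opNorm_comp_le _ _)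
            (ContinuousLinearMap.opNorm_comp_le _ _))
      _ ≤ (1 * ((1 + h * C) * ‖U - W‖)) * (1 + h * C) + 1 * (h * (C * ‖U - W‖)) := by
          gcongr
          · exact (hg2 _ _).trans (by gcongr; exact hEl U W)
          · exact hJ U
          · exact hg1 _
      _ = (1 + 3 * (h * C) + h * h * C ^ 2) * ‖U - W‖ := by ring
      _ ≤ (1 + h * (3 * C + C ^ 2)) * ‖U - W‖ :=
          mul_le_mul_of_nonneg_right (by linarith) (norm_nonneg _)

/-- Bound for a second derivative of `g` that needs only the Lipschitz bound on `Dg`. The vector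
field `w` may be unbounded: only its value at `U` enters. -/
theorem norm_fderiv_apply_le {V : Type*} [NormedAddCommGroup V] [NormedSpace ℝ V] {g : V → ℝ}
    {w : V → V} (hw : Differentiable ℝ w)
    (hg1 : ∀ U, ‖fderiv ℝ g U‖ ≤ 1)
    (hg2 : ∀ U W, ‖fderiv ℝ g U - fderiv ℝ g W‖ ≤ 1 * ‖U - W‖) {C : ℝ}
    (hw1 : ∀ U, ‖fderiv ℝ w U‖ ≤ C) (U : V) :
    ‖fderiv ℝ (fun U => fderiv ℝ g U (w U)) U‖ ≤ C + ‖w U‖ := by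
  have hC : 0 ≤ C := (norm_nonneg _).trans (hw1 0)
  have hwl : ∀ Z, ‖w Z - w U‖ ≤ C * ‖Z - U‖ := fun Z =>
    Convex.norm_image_sub_le_of_norm_fderiv_le (𝕜 := ℝ) (s := univ)
      (fun z _ => hw z) (fun z _ => hw1 z) convex_univ (mem_univ _) (mem_univ _)
  refine norm_fderiv_le_of_lip' ℝ (by positivity) (Eventually.of_forall fun Z => ?_)
  have hsplit : fderiv ℝ g Z (w Z) - fderiv ℝ g U (w U)
      = fderiv ℝ g Z (w Z - w U) + (fderiv ℝ g Z - fderiv ℝ g U) (w U) := by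
    simp
  rw [hsplit]
  calc _ ≤ ‖fderiv ℝ g Z‖ * ‖w Z - w U‖ + ‖fderiv ℝ g Z - fderiv ℝ g U‖ * ‖w U‖ :=
        (norm_add_le _ _).trans (add_le_add (ContinuousLinearMap.le_opNorm _ _)
          (ContinuousLinearMap.le_opNorm _ _))
    _ ≤ 1 * (C * ‖Z - U‖) + 1 * ‖Z - U‖ * ‖w U‖ := by
        gcongr
        · exact hg1 _
        · exact hwl Z
        · exact hg2 _ _
    _ = _ := by ring

/-! ### The test class -/

theorem hasFDerivAt_drift (κ : ℝ) (m U A : Mat d) :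
    HasFDerivAt (fun U => drift κ m U A) (ContinuousLinearMap.mul ℝ (Mat d) A +
      (κ / 2) • (fderiv ℝ coupling (m, U)).comp (ContinuousLinearMap.inr ℝ (Mat d) (Mat d))) U := by
  have h1 : HasFDerivAt (fun U : Mat d => A * U) (ContinuousLinearMap.mul ℝ (Mat d) A) U :=
    (ContinuousLinearMap.mul ℝ (Mat d) A).hasFDerivAt
  have h2 : HasFDerivAt (fun U : Mat d => coupling (m, U))
      ((fderiv ℝ coupling (m, U)).comp (ContinuousLinearMap.inr ℝ (Mat d) (Mat d))) U :=
    HasFDerivAt.comp (f := fun U : Mat d => (m, U)) U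
      (contDiff_coupling.differentiable (by simp) (m, U)).hasFDerivAt (hasFDerivAt_prodMk_right m U)
  exact h1.add (h2.const_smul (κ / 2))

/-- Bounds on the drift for bounded `A`, uniform in the average `m`. -/
structure DriftBound (d : ℕ) (κ R C : ℝ) : Prop where
  fderiv : ∀ (m A U : Mat d), ‖A‖ ≤ R → ‖fderiv ℝ (fun U => drift κ m U A) U‖ ≤ C
  lip : ∀ (m A U W : Mat d), ‖A‖ ≤ R → ‖_root_.fderiv ℝ (fun U => drift κ m U A) U
    - _root_.fderiv ℝ (fun U => drift κ m U A) W‖ ≤ C * ‖U - W‖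
  value : ∀ (m A : Mat d) (U : Matrix.unitaryGroup (Fin d) ℂ), ‖A‖ ≤ R → ‖drift κ m U A‖ ≤ C
  mean : ∀ m m' U A : Mat d, ‖drift κ m U A - drift κ m' U A‖ ≤ C * ‖m - m'‖

theorem exists_driftBound (d : ℕ) (κ R : ℝ) : ∃ C, 0 ≤ C ∧ DriftBound d κ R C := by
  have hsm : ContDiff ℝ ∞ (fderiv ℝ (coupling (d := d))) :=
    contDiff_coupling.fderiv_right (by simp)
  have hsupp : HasCompactSupport (fderiv ℝ (coupling (d := d))) :=
    hasCompactSupport_coupling.fderiv ℝ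
  obtain ⟨L₀, hL₀⟩ := exists_lipschitz_coupling (d := d)
  obtain ⟨B₁, hB₁⟩ := hsupp.exists_bound_of_continuous hsm.continuous
  obtain ⟨L₁, hL₁⟩ := ContDiff.lipschitzWith_of_hasCompactSupport hsupp hsm (by simp)
  obtain ⟨B, hB0, hB⟩ := exists_norm_drift_le d κ
  have hB₁0 : 0 ≤ B₁ := (norm_nonneg _).trans (hB₁ 0)
  have hinr : ‖ContinuousLinearMap.inr ℝ (Mat d) (Mat d)‖ ≤ 1 :=
    ContinuousLinearMap.norm_inr_le_one ℝ (Mat d) (Mat d)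
  let k := ‖κ / 2‖
  have hk : 0 ≤ k := norm_nonneg _
  have e0 : 0 ≤ |R| * d := by positivity
  have e1 : 0 ≤ k * B₁ := by positivity
  have e2 : 0 ≤ k * L₀ := by positivity
  have e3 : 0 ≤ k * L₁ := by positivity
  have e4 := abs_nonneg R
  have hcomp : ∀ T : Mat d × Mat d →L[ℝ] Mat d,
      ‖(κ / 2) • T.comp (ContinuousLinearMap.inr ℝ (Mat d) (Mat d))‖ ≤ k * ‖T‖ := by
    intro T
    rw [norm_smul]
    refine mul_le_mul_of_nonneg_left ?_ hk
    refine (ContinuousLinearMap.opNorm_comp_le _ _).trans ?_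
    exact mul_le_of_le_one_right (norm_nonneg _) hinr
  refine ⟨|R| + |R| * d + B + k * B₁ + k * L₀ + k * L₁, by positivity, ?_, ?_, ?_, ?_⟩
  · intro m A U hA
    rw [(hasFDerivAt_drift κ m U A).fderiv]
    have h1 := ContinuousLinearMap.opNorm_mul_apply_le ℝ (Mat d) A
    have h2 := (hcomp (fderiv ℝ coupling (m, U))).trans
      (mul_le_mul_of_nonneg_left (hB₁ (m, U)) hk)
    refine (norm_add_le _ _).trans ?_
    have := hA.trans (le_abs_self R)
    linarith
  · intro m A U W hA
    rw [(hasFDerivAt_drift κ m U A).fderiv, (hasFDerivAt_drift κ m W A).fderiv,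
      add_sub_add_left_eq_sub]
    have h1 := hL₁.norm_sub_le (m, U) (m, W)
    rw [Prod.mk_sub_mk, sub_self, Prod.norm_mk, norm_zero, max_eq_right (norm_nonneg _)] at h1
    have hsub := smul_sub (κ / 2)
      ((fderiv ℝ coupling (m, U)).comp (ContinuousLinearMap.inr ℝ (Mat d) (Mat d)))
      ((fderiv ℝ coupling (m, W)).comp (ContinuousLinearMap.inr ℝ (Mat d) (Mat d)))
    refine (congrArg norm hsub).ge.trans ?_
    rw [← ContinuousLinearMap.sub_comp]
    refine (hcomp _).trans ((mul_le_mul_of_nonneg_left h1 hk).trans ?_)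
    rw [← mul_assoc]
    exact mul_le_mul_of_nonneg_right (by linarith) (norm_nonneg _)
  · intro m A U hA
    refine (hB m A U).trans ?_
    have : ‖A‖ * d ≤ |R| * d := by gcongr; exact hA.trans (le_abs_self R)
    linarith
  · intro m m' U A
    have h1 := hL₀.norm_sub_le (m, U) (m', U)
    rw [Prod.mk_sub_mk, sub_self, Prod.norm_mk, norm_zero, max_eq_left (norm_nonneg _)] at h1
    unfold drift
    rw [add_sub_add_left_eq_sub, ← smul_sub, norm_smul]
    refine (mul_le_mul_of_nonneg_left h1 hk).trans ?_
    rw [← mul_assoc]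
    exact mul_le_mul_of_nonneg_right (by linarith) (norm_nonneg _)

theorem differentiable_drift (κ : ℝ) (m A : Mat d) : Differentiable ℝ fun U => drift κ m U A :=
  fun U => (hasFDerivAt_drift κ m U A).differentiableAt

/-- One step of the explicit Euler scheme for the characteristics. -/
noncomputable def eulerStep (κ : ℝ) (m : Mat d) (h : ℝ) (z : Mat d × Mat d) : Mat d × Mat d :=
  (z.1 + h • drift κ m z.1 z.2, z.2)

theorem contDiff_eulerStep (κ : ℝ) (m : Mat d) (h : ℝ) : ContDiff ℝ ∞ (eulerStep κ m h) := by
  have h1 : ContDiff ℝ ∞ fun z : Mat d × Mat d => drift κ m z.1 z.2 :=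
    (contDiff_drift κ).comp (contDiff_const.prodMk contDiff_id)
  exact (contDiff_fst.add (h1.const_smul h)).prodMk contDiff_snd

/-- Smooth test functions vanishing for `‖A‖ > R`, with `C^{1,1}` bound `a` in `U`. -/
structure TestClass (R a : ℝ) (φ : Mat d × Mat d → ℝ) : Prop extends HasC11Bound a φ where
  smooth : ContDiff ℝ ∞ φ
  vanish : VanishesBeyond R φ

theorem TestClass.const_mul {R a : ℝ} {φ : Mat d × Mat d → ℝ} (hφ : TestClass R a φ) {c : ℝ}
    (hc : 0 ≤ c) : TestClass R (c * a) fun z => c * φ z := by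
  have hs : ∀ A, Differentiable ℝ fun U => φ (U, A) := fun A =>
    (hφ.smooth.differentiable (by simp)).comp (differentiable_id.prodMk (differentiable_const A))
  have hd : ∀ A U, fderiv ℝ (fun U => c * φ (U, A)) U = c • fderiv ℝ (fun U => φ (U, A)) U :=
    fun A U => fderiv_const_mul (hs A U) c
  refine ⟨⟨fun z => ?_, fun A U => ?_, fun A U V => ?_⟩, contDiff_const.mul hφ.smooth,
    fun U A hA => ?_⟩
  · rw [abs_mul, abs_of_nonneg hc]
    exact mul_le_mul_of_nonneg_left (hφ.value z) hc
  · rw [hd, norm_smul, Real.norm_of_nonneg hc]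
    exact mul_le_mul_of_nonneg_left (hφ.deriv A U) hc
  · rw [hd, hd, ← smul_sub, norm_smul, Real.norm_of_nonneg hc, mul_assoc]
    exact mul_le_mul_of_nonneg_left (hφ.lip A U V) hc
  · simp [hφ.vanish U A hA]

theorem TestClass.comp_eulerStep {κ R C : ℝ} (hC0 : 0 ≤ C) (hC : DriftBound d κ R C)
    {φ : Mat d × Mat d → ℝ} (hφ : TestClass R 1 φ) (m : Mat d) {h : ℝ} (h0 : 0 ≤ h) (h1 : h ≤ 1) :
    TestClass R (1 + h * (3 * C + C ^ 2)) (φ ∘ eulerStep κ m h) := by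
  have hs : ∀ A, Differentiable ℝ fun U => φ (U, A) := fun A =>
    (hφ.smooth.differentiable (by simp)).comp (differentiable_id.prodMk (differentiable_const A))
  have hv : VanishesBeyond R (φ ∘ eulerStep κ m h) := fun U A hA => hφ.vanish _ A hA
  have hpos : 0 ≤ h * (3 * C + C ^ 2) := by positivity
  have hcase : ∀ A : Mat d, R < ‖A‖ → ∀ U,
      fderiv ℝ (fun U => (φ ∘ eulerStep κ m h) (U, A)) U = 0 := by
    intro A hA U
    have : (fun U => (φ ∘ eulerStep κ m h) (U, A)) = fun _ => 0 := funext fun U => hv U A hA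
    rw [this, fderiv_const_apply]
  have hb := fun (A : Mat d) (hA : ‖A‖ ≤ R) => fderiv_comp_euler_bounds (hs A)
    (differentiable_drift κ m A) (hφ.deriv A) (hφ.lip A) (fun U => hC.fderiv m A U hA)
    (fun U W => hC.lip m A U W hA) h0 h1
  refine ⟨⟨fun z => (hφ.value _).trans (by linarith), fun A U => ?_, fun A U V => ?_⟩,
    hφ.smooth.comp (contDiff_eulerStep κ m h), hv⟩
  · rcases le_or_gt ‖A‖ R with hA | hA
    · exact (hb A hA).1 U
    · rw [hcase A hA, norm_zero]
      positivity
  · rcases le_or_gt ‖A‖ R with hA | hA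
    · exact (hb A hA).2 U V
    · rw [hcase A hA, hcase A hA, sub_zero, norm_zero]
      positivity

/-! ### Consistency of the Euler scheme -/

/-- The pairing `∫ ψ dμ` of a function on the ambient space with a measure on the phase space. -/
noncomputable def pairing (ψ : Mat d × Mat d → ℝ) (μ : P1 d) : ℝ :=
  ∫ x, ψ (coords x) ∂μ.1.toMeasure

theorem fderiv_apply_fst_eq {V W : Type*} [NormedAddCommGroup V] [NormedSpace ℝ V]
    [NormedAddCommGroup W] [NormedSpace ℝ W] {ψ : V × W → ℝ} (hψ : Differentiable ℝ ψ)
    (z : V × W) (v : V) :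
    fderiv ℝ ψ z (v, 0) = fderiv ℝ (fun U => ψ (U, z.2)) z.1 v := by
  have h : HasFDerivAt (fun U => ψ (U, z.2))
      ((fderiv ℝ ψ z).comp (ContinuousLinearMap.inl ℝ V W)) z.1 :=
    HasFDerivAt.comp (f := fun U : V => (U, z.2)) z.1 (hψ z).hasFDerivAt
      (hasFDerivAt_prodMk_left z.1 z.2)
  rw [h.fderiv]
  simp

theorem VanishesBeyond.fderiv_eq_zero {R : ℝ} {ψ : Mat d × Mat d → ℝ} (hψ : VanishesBeyond R ψ)
    {A : Mat d} (hA : R < ‖A‖) (U : Mat d) : fderiv ℝ (fun U => ψ (U, A)) U = 0 := by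
  have : (fun U => ψ (U, A)) = fun _ => 0 := funext fun U => hψ U A hA
  rw [this, fderiv_const_apply]

theorem TestClass.abs_fderiv_le {κ R C : ℝ} (hC0 : 0 ≤ C) (hC : DriftBound d κ R C)
    {φ : Mat d × Mat d → ℝ} (hφ : TestClass R 1 φ) (m : Mat d) (x : Phase d) :
    |fderiv ℝ φ (coords x) (drift κ m x.1 x.2, 0)| ≤ C := by
  rw [fderiv_apply_fst_eq (hφ.smooth.differentiable (by simp))]
  rcases le_or_gt ‖(x.2 : Mat d)‖ R with hA | hA
  · rw [← Real.norm_eq_abs]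
    refine (ContinuousLinearMap.le_opNorm _ _).trans ?_
    calc _ ≤ 1 * C := by
          gcongr
          · exact hφ.deriv _ _
          · exact hC.value m _ x.1 hA
      _ = C := one_mul C
  · have h0 : fderiv ℝ (fun U => φ (U, (coords x).2)) (coords x).1 = 0 :=
      hφ.vanish.fderiv_eq_zero hA _
    rw [h0]
    simpa using hC0

theorem TestClass.integrable {R a : ℝ} {φ : Mat d × Mat d → ℝ} (hφ : TestClass R a φ) (μ : P1 d) :
    Integrable (fun x => φ (coords x)) μ.1.toMeasure :=
  .of_bound (hφ.smooth.continuous.comp continuous_coords).aestronglyMeasurable a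
    (ae_of_all _ fun _ => hφ.value _)

theorem TestClass.integrable_fderiv {κ R C : ℝ} (hC0 : 0 ≤ C) (hC : DriftBound d κ R C)
    {φ : Mat d × Mat d → ℝ} (hφ : TestClass R 1 φ) (m : Mat d) (μ : P1 d) :
    Integrable (fun x => fderiv ℝ φ (coords x) (drift κ m x.1 x.2, 0)) μ.1.toMeasure := by
  refine .of_bound (Continuous.aestronglyMeasurable ?_) C
    (ae_of_all _ fun x => hφ.abs_fderiv_le hC0 hC m x)
  have h := (contDiff_fderiv_drift κ hφ.smooth).continuous
  exact h.comp (continuous_const.prodMk continuous_coords)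

theorem abs_pairing_le {R a : ℝ} {φ : Mat d × Mat d → ℝ} (hφ : TestClass R a φ) (μ : P1 d) :
    |pairing φ μ| ≤ a := by
  rw [← Real.norm_eq_abs]
  refine (norm_integral_le_of_norm_le_const (C := a) (ae_of_all _ fun x => ?_)).trans (by simp)
  exact hφ.value _

/-- A curve satisfying the hypotheses under which linear transport is unique. -/
structure IsLinearSolution (κ : ℝ) (M : ℝ≥0 → Mat d) (f : ℝ≥0 → P1 d) : Prop where
  continuous_mean : Continuous M
  norm_mean : ∀ t, ‖M t‖ ≤ d
  continuousMK1 : ContinuousMK1 f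
  weak : IsLinearWeakSolution κ M f

theorem IsLinearSolution.abs_pairing_sub_le {κ : ℝ} {M : ℝ≥0 → Mat d} {f : ℝ≥0 → P1 d}
    (hf : IsLinearSolution κ M f) {ψ : Mat d × Mat d → ℝ} (hψ : ContDiff ℝ ∞ ψ) {R : ℝ}
    (hR : VanishesBeyond R ψ) {B : ℝ}
    (hB : ∀ m x, |fderiv ℝ ψ (coords x) (drift κ m x.1 x.2, 0)| ≤ B) {s t : ℝ} (hs : 0 ≤ s)
    (ht : 0 ≤ t) : |pairing ψ (f t.toNNReal) - pairing ψ (f s.toNNReal)| ≤ B * |t - s| := by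
  unfold pairing
  rw [(integral_sub_integral_eq hf.continuous_mean hf.norm_mean hf.continuousMK1 hf.weak hψ
    hR).2 s t hs ht, ← Real.norm_eq_abs]
  refine intervalIntegral.norm_integral_le_of_norm_le_const fun r _ => ?_
  exact (norm_integral_le_of_norm_le_const (ae_of_all _ fun x => hB _ x)).trans (by simp)

/-- Consistency of the Euler scheme, uniformly over the test class: up to `o(h)`, transport over a
time `h` is push-forward under an Euler step. -/
theorem IsLinearSolution.eventually_abs_pairing_sub_le {κ : ℝ} {M : ℝ≥0 → Mat d} {f : ℝ≥0 → P1 d}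
    (hf : IsLinearSolution κ M f) {R C : ℝ} (hC0 : 0 ≤ C) (hC : DriftBound d κ R C) {t : ℝ}
    (ht : 0 ≤ t) {ε : ℝ} (hε : 0 < ε) :
    ∀ᶠ h in 𝓝[>] (0 : ℝ), ∀ φ, TestClass R 1 φ →
      |pairing φ (f (t + h).toNNReal) - pairing (φ ∘ eulerStep κ (M t.toNNReal) h) (f t.toNNReal)|
        ≤ ε * h := by
  have hMt : Continuous fun r : ℝ => M r.toNNReal :=
    hf.continuous_mean.comp continuous_real_toNNReal
  -- The error per unit time is `C ‖M r - M t‖` from the average, `2 C² h` from the motion of the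
  -- solution and `C² h` from Taylor's formula; the first and the sum of the others are kept
  -- below `ε / 2`.
  obtain ⟨δ, hδ, hMδ⟩ := Metric.continuous_iff.1 hMt t (ε / (2 * (C + 1))) (by positivity)
  have hev : ∀ᶠ h in 𝓝[>] (0 : ℝ), h ∈ Ioo 0 (min δ (ε / (2 * (3 * C ^ 2 + 1)))) :=
    Ioo_mem_nhdsGT (by positivity)
  filter_upwards [hev] with h hh φ hφ
  have h0 : 0 < h := hh.1
  have hhδ : h < δ := hh.2.trans_le (min_le_left _ _)
  have hhε : 3 * C ^ 2 * h ≤ ε / 2 := by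
    have h1 := (hh.2.trans_le (min_le_right _ _)).le
    rw [le_div_iff₀ (by positivity)] at h1
    nlinarith
  set m := M t.toNNReal with hm
  let ζ : Mat d × Mat d → ℝ := fun z => fderiv ℝ φ z (drift κ m z.1 z.2, 0)
  have hφd : Differentiable ℝ φ := hφ.smooth.differentiable (by simp)
  have hζeq : ∀ z : Mat d × Mat d,
      ζ z = fderiv ℝ (fun U => φ (U, z.2)) z.1 (drift κ m z.1 z.2) :=
    fun z => fderiv_apply_fst_eq hφd z _
  have hζ : ContDiff ℝ ∞ ζ :=
    (contDiff_fderiv_drift κ hφ.smooth).comp (contDiff_const.prodMk contDiff_id)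
  have hζR : VanishesBeyond R ζ := fun U A hA => by
    rw [hζeq, hφ.vanish.fderiv_eq_zero hA]
    rfl
  have hζB : ∀ m' x, |fderiv ℝ ζ (coords x) (drift κ m' x.1 x.2, 0)| ≤ (C + C) * C := by
    intro m' x
    rw [fderiv_apply_fst_eq (hζ.differentiable (by simp))]
    rcases le_or_gt ‖(x.2 : Mat d)‖ R with hA | hA
    · rw [← Real.norm_eq_abs]
      refine (ContinuousLinearMap.le_opNorm _ _).trans ?_
      gcongr
      · simp only [hζeq]
        refine (norm_fderiv_apply_le (differentiable_drift κ m _) (hφ.deriv _) (hφ.lip _)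
          (fun U => hC.fderiv m _ U hA) _).trans ?_
        gcongr
        exact hC.value m _ x.1 hA
      · exact hC.value m' _ x.1 hA
    · have h0 : fderiv ℝ (fun U => ζ (U, (coords x).2)) (coords x).1 = 0 :=
        hζR.fderiv_eq_zero hA _
      rw [h0]
      have : 0 ≤ (C + C) * C := by positivity
      simpa using this
  let c : ℝ → ℝ := fun r => ∫ x, fderiv ℝ φ (coords x) (drift κ (M r.toNNReal) x.1 x.2, 0)
    ∂(f r.toNNReal).1.toMeasure
  obtain ⟨hc, hI⟩ := integral_sub_integral_eq hf.continuous_mean hf.norm_mean hf.continuousMK1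
    hf.weak hφ.smooth hφ.vanish
  have hcc : Continuous c := hc.comp continuous_real_toNNReal
  have hI := hI t (t + h) ht (by linarith)
  -- The velocity along the solution stays close to its value at time `t`.
  have hcr : ∀ r ∈ Set.uIoc t (t + h), ‖c r - pairing ζ (f t.toNNReal)‖
      ≤ ε / 2 + 2 * C ^ 2 * h := by
    intro r hr
    rw [uIoc_of_le (by linarith)] at hr
    have hr0 : 0 ≤ r := by linarith [hr.1]
    have e1 : ‖c r - pairing ζ (f r.toNNReal)‖ ≤ ε / 2 := by
      have hsub : c r - pairing ζ (f r.toNNReal) = _ :=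
        (integral_sub (hφ.integrable_fderiv hC0 hC (M r.toNNReal) _)
          (hφ.integrable_fderiv hC0 hC m _)).symm
      rw [hsub]
      refine (norm_integral_le_of_norm_le_const (C := ε / 2) (ae_of_all _ fun x => ?_)).trans
        (by simp)
      have hd1 : ‖M r.toNNReal - m‖ ≤ ε / (2 * (C + 1)) := by
        rw [← dist_eq_norm]
        refine (hMδ r ?_).le
        rw [Real.dist_eq, abs_of_pos (by linarith [hr.1])]
        linarith [hr.2]
      have hφx : ∀ m', fderiv ℝ φ (coords x) (drift κ m' x.1 x.2, 0)
          = fderiv ℝ (fun U => φ (U, (x.2 : Mat d))) x.1 (drift κ m' x.1 x.2) :=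
        fun m' => fderiv_apply_fst_eq hφd (coords x) _
      rw [hφx, hφx, ← map_sub]
      calc _ ≤ 1 * (C * (ε / (2 * (C + 1)))) := by
            refine (ContinuousLinearMap.le_opNorm _ _).trans ?_
            gcongr
            · exact hφ.deriv _ _
            · exact (hC.mean _ _ _ _).trans (by gcongr)
        _ = C / (C + 1) * (ε / 2) := by field_simp
        _ ≤ 1 * (ε / 2) := by
            gcongr
            rw [div_le_one (by linarith)]
            linarith
        _ = ε / 2 := one_mul _
    have e2 : ‖pairing ζ (f r.toNNReal) - pairing ζ (f t.toNNReal)‖ ≤ 2 * C ^ 2 * h := by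
      refine (hf.abs_pairing_sub_le hζ hζR hζB ht hr0).trans ?_
      rw [abs_of_pos (by linarith [hr.1])]
      calc (C + C) * C * (r - t) ≤ (C + C) * C * h := by
            gcongr
            linarith [hr.2]
        _ = _ := by ring
    calc _ ≤ ‖c r - pairing ζ (f r.toNNReal)‖ +
          ‖pairing ζ (f r.toNNReal) - pairing ζ (f t.toNNReal)‖ :=
        norm_sub_le_norm_sub_add_norm_sub _ _ _
      _ ≤ _ := add_le_add e1 e2
  have hmain : |pairing φ (f (t + h).toNNReal) - pairing φ (f t.toNNReal)
      - h * pairing ζ (f t.toNNReal)| ≤ (ε / 2 + 2 * C ^ 2 * h) * h := by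
    have hconst : h * pairing ζ (f t.toNNReal) = ∫ _r in t..(t + h), pairing ζ (f t.toNNReal) := by
      simp
    have hIc : pairing φ (f (t + h).toNNReal) - pairing φ (f t.toNNReal)
        = ∫ r in t..(t + h), c r := hI
    rw [hIc, hconst, ← intervalIntegral.integral_sub (hcc.intervalIntegrable _ _)
      intervalIntegrable_const, ← Real.norm_eq_abs]
    refine (intervalIntegral.norm_integral_le_of_norm_le_const hcr).trans (le_of_eq ?_)
    rw [add_sub_cancel_left, abs_of_pos h0]
  -- Taylor's formula for the Euler step.
  have htaylor : |pairing (φ ∘ eulerStep κ m h) (f t.toNNReal) - pairing φ (f t.toNNReal)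
      - h * pairing ζ (f t.toNNReal)| ≤ C ^ 2 * h * h := by
    have hiE : Integrable (fun x => (φ ∘ eulerStep κ m h) (coords x)) (f t.toNNReal).1.toMeasure :=
      .of_bound ((hφ.smooth.continuous.comp (contDiff_eulerStep κ m h).continuous).comp
        continuous_coords).aestronglyMeasurable 1 (ae_of_all _ fun _ => hφ.value _)
    have hiζ : Integrable (fun x => ζ (coords x)) (f t.toNNReal).1.toMeasure :=
      hφ.integrable_fderiv hC0 hC m _
    have hsub : pairing (φ ∘ eulerStep κ m h) (f t.toNNReal) - pairing φ (f t.toNNReal)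
        - h * pairing ζ (f t.toNNReal) = ∫ x, ((φ ∘ eulerStep κ m h) (coords x) - φ (coords x)
          - h * ζ (coords x)) ∂(f t.toNNReal).1.toMeasure := by
      unfold pairing
      rw [← integral_const_mul, ← integral_sub hiE (hφ.integrable _)]
      exact (integral_sub (hiE.sub (hφ.integrable _)) (hiζ.const_mul h)).symm
    rw [hsub, ← Real.norm_eq_abs]
    refine (norm_integral_le_of_norm_le_const (C := C ^ 2 * h * h) (ae_of_all _ fun x => ?_)).trans
      (by simp)
    rcases le_or_gt ‖(x.2 : Mat d)‖ R with hA | hA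
    · have hφA : Differentiable ℝ fun U => φ (U, (x.2 : Mat d)) :=
        hφd.comp (differentiable_id.prodMk (differentiable_const _))
      have h1 := norm_sub_sub_fderiv_le hφA zero_le_one (hφ.lip x.2) x.1 (h • drift κ m x.1 x.2)
      rw [map_smul, norm_smul, Real.norm_of_nonneg h0.le] at h1
      rw [hζeq]
      refine h1.trans ?_
      calc 1 * (h * ‖drift κ m x.1 x.2‖) ^ 2 ≤ 1 * (h * C) ^ 2 := by
            gcongr
            exact hC.value m _ x.1 hA
        _ = _ := by ring
    · have e1 : (φ ∘ eulerStep κ m h) (coords x) = 0 := hφ.vanish _ _ hA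
      have e2 : φ (coords x) = 0 := hφ.vanish _ _ hA
      have e3 : ζ (coords x) = 0 := hζR _ _ hA
      rw [e1, e2, e3]
      simp only [mul_zero, sub_zero, norm_zero]
      positivity
  rw [abs_le] at hmain htaylor ⊢
  have hfin : 3 * C ^ 2 * h * h ≤ ε / 2 * h := mul_le_mul_of_nonneg_right hhε h0.le
  constructor <;> nlinarith

/-! ### Uniqueness for linear transport -/

theorem testClass_zero (R : ℝ) : TestClass R 1 (fun _ : Mat d × Mat d => (0 : ℝ)) := by
  refine ⟨⟨fun z => by simp, fun A U => by simp, fun A U V => by simp⟩, contDiff_const,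
    fun U A _ => rfl⟩

theorem exists_testClass {ψ : Mat d × Mat d → ℝ} (hψ : ContDiff ℝ ∞ ψ)
    (hψs : HasCompactSupport ψ) : ∃ R a : ℝ, 0 < a ∧ TestClass R a ψ := by
  have hsm : ContDiff ℝ ∞ (fderiv ℝ ψ) := hψ.fderiv_right (by simp)
  have hsupp : HasCompactSupport (fderiv ℝ ψ) := hψs.fderiv ℝ
  obtain ⟨B₀, hB₀⟩ := hψs.exists_bound_of_continuous hψ.continuous
  obtain ⟨B₁, hB₁⟩ := hsupp.exists_bound_of_continuous hsm.continuous
  obtain ⟨L, hL⟩ := ContDiff.lipschitzWith_of_hasCompactSupport hsupp hsm (by simp)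
  have hB₀0 : 0 ≤ B₀ := (norm_nonneg _).trans (hB₀ 0)
  have hB₁0 : 0 ≤ B₁ := (norm_nonneg _).trans (hB₁ 0)
  have hL0 : (0 : ℝ) ≤ L := L.2
  obtain ⟨R, hR⟩ := hψs.isCompact.isBounded.subset_closedBall 0
  have hinl : ‖ContinuousLinearMap.inl ℝ (Mat d) (Mat d)‖ ≤ 1 :=
    ContinuousLinearMap.norm_inl_le_one ℝ (Mat d) (Mat d)
  have hd : ∀ A U, fderiv ℝ (fun U => ψ (U, A)) U
      = (fderiv ℝ ψ (U, A)).comp (ContinuousLinearMap.inl ℝ (Mat d) (Mat d)) := fun A U =>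
    (HasFDerivAt.comp (f := fun U : Mat d => (U, A)) U
      (hψ.differentiable (by simp) (U, A)).hasFDerivAt (hasFDerivAt_prodMk_left U A)).fderiv
  have hcomp : ∀ T : Mat d × Mat d →L[ℝ] ℝ,
      ‖T.comp (ContinuousLinearMap.inl ℝ (Mat d) (Mat d))‖ ≤ ‖T‖ := fun T =>
    (ContinuousLinearMap.opNorm_comp_le _ _).trans (mul_le_of_le_one_right (norm_nonneg _) hinl)
  refine ⟨R, B₀ + B₁ + L + 1, by positivity,
    ⟨⟨fun z => (hB₀ z).trans (by linarith), fun A U => ?_, fun A U V => ?_⟩, hψ, fun U A hA => ?_⟩⟩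
  · rw [hd]
    exact (hcomp _).trans ((hB₁ _).trans (by linarith))
  · rw [hd, hd, ← ContinuousLinearMap.sub_comp]
    have h1 := hL.norm_sub_le (U, A) (V, A)
    rw [Prod.mk_sub_mk, sub_self, Prod.norm_mk, norm_zero, max_eq_left (norm_nonneg _)] at h1
    exact (hcomp _).trans (h1.trans (mul_le_mul_of_nonneg_right (by linarith) (norm_nonneg _)))
  · by_contra hne
    have h1 := hR (subset_tsupport ψ hne)
    rw [mem_closedBall_zero_iff] at h1
    exact absurd ((norm_snd_le (U, A)).trans h1) (not_le.2 hA)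

/-- The indicator function of an open set is a pointwise limit of smooth compactly supported
functions with values in `[0, 1]`. -/
theorem exists_contDiff_tendsto_indicator {E : Type*} [NormedAddCommGroup E] [NormedSpace ℝ E]
    [FiniteDimensional ℝ E] {s : Set E} (hs : IsOpen s) :
    ∃ ψ : ℕ → E → ℝ, (∀ n, ContDiff ℝ ∞ (ψ n)) ∧ (∀ n, HasCompactSupport (ψ n)) ∧
      (∀ n x, ‖ψ n x‖ ≤ 1) ∧
      ∀ x, Tendsto (fun n => ψ n x) atTop (𝓝 (s.indicator (fun _ => 1) x)) := by
  obtain ⟨f, hfs, hf, hf01⟩ := hs.exists_contDiff_support_eq (n := ⊤)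
  have hf0 : ∀ x, 0 ≤ f x := fun x => (hf01 (mem_range_self x)).1
  let χ : ℕ → ContDiffBump (0 : E) := fun n => ⟨n + 1, n + 2, by positivity, by linarith⟩
  refine ⟨fun n x => χ n x * Real.smoothTransition (n * f x), fun n => ?_, fun n => ?_,
    fun n x => ?_, fun x => ?_⟩
  · exact (χ n).contDiff.mul (Real.smoothTransition.contDiff.comp (contDiff_const.mul hf))
  · exact (χ n).hasCompactSupport.mul_right
  · rw [norm_mul, Real.norm_of_nonneg (χ n).nonneg,
      Real.norm_of_nonneg (Real.smoothTransition.nonneg _)]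
    exact mul_le_one₀ (χ n).le_one (Real.smoothTransition.nonneg _)
      (Real.smoothTransition.le_one _)
  · by_cases hx : x ∈ s
    · have hfx : 0 < f x := (hf0 x).lt_of_ne' (by rwa [← Function.mem_support, hfs])
      rw [indicator_of_mem hx]
      refine tendsto_const_nhds.congr' ?_
      obtain ⟨n₁, hn₁⟩ := exists_nat_ge ‖x‖
      obtain ⟨n₂, hn₂⟩ := exists_nat_ge (1 / f x)
      filter_upwards [eventually_ge_atTop n₁, eventually_ge_atTop n₂] with n h1 h2
      have e1 : χ n x = 1 := by
        apply (χ n).one_of_mem_closedBall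
        rw [mem_closedBall_zero_iff]
        have : (n₁ : ℝ) ≤ n := by exact_mod_cast h1
        change ‖x‖ ≤ (n : ℝ) + 1
        linarith
      have e2 : Real.smoothTransition (n * f x) = 1 := by
        apply Real.smoothTransition.one_of_one_le
        have : (n₂ : ℝ) ≤ n := by exact_mod_cast h2
        rw [← div_le_iff₀ hfx]
        linarith
      rw [e1, e2, one_mul]
    · have hfx : f x = 0 := by rwa [← Function.notMem_support, hfs]
      simp [hx, hfx, Real.smoothTransition.zero]

/-- Smooth compactly supported functions on the ambient space separate the probability measures on
the phase space. -/
theorem P1.ext_of_pairing {μ ν : P1 d}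
    (h : ∀ ψ : Mat d × Mat d → ℝ, ContDiff ℝ ∞ ψ → HasCompactSupport ψ →
      pairing ψ μ = pairing ψ ν) : μ = ν := by
  refine Subtype.ext (Subtype.ext ?_)
  change μ.1.toMeasure = ν.1.toMeasure
  refine ext_of_generate_finite {s : Set (Phase d) | IsOpen s} (BorelSpace.measurable_eq)
    isPiSystem_isOpen (fun s hs => ?_) (by simp)
  have hind : Topology.IsInducing (coords (d := d)) :=
    (Topology.IsInducing.subtypeVal).prodMap (Topology.IsInducing.subtypeVal)
  obtain ⟨O, hO, rfl⟩ := hind.isOpen_iff.1 hs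
  obtain ⟨ψ, hψ, hψs, hψ1, hlim⟩ := exists_contDiff_tendsto_indicator hO
  have hreal : ∀ μ : P1 d, Tendsto (fun n => pairing (ψ n) μ) atTop
      (𝓝 (μ.1.toMeasure.real (coords ⁻¹' O))) := by
    intro μ
    have h1 := tendsto_integral_of_dominated_convergence (μ := μ.1.toMeasure) (fun _ => (1 : ℝ))
      (F := fun n x => ψ n (coords x)) (f := fun x => O.indicator (fun _ => 1) (coords x))
      (fun n => ((hψ n).continuous.comp continuous_coords).aestronglyMeasurable)
      (integrable_const _) (fun n => ae_of_all _ fun x => hψ1 n _)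
      (ae_of_all _ fun x => hlim (coords x))
    have h2 : ∫ x, O.indicator (fun _ => (1 : ℝ)) (coords x) ∂μ.1.toMeasure
        = μ.1.toMeasure.real (coords ⁻¹' O) :=
      integral_indicator_one (hO.preimage continuous_coords).measurableSet
    rw [h2] at h1
    exact h1
  have heq := tendsto_nhds_unique (hreal μ)
    ((hreal ν).congr fun n => (h (ψ n) (hψ n) (hψs n)).symm)
  exact (measureReal_eq_measureReal_iff).1 heq

/-- Uniqueness for the linear transport equation. The dual distance of two solutions over the test
class satisfies Gronwall's inequality, since the class is stable under Euler steps up to a factor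
`1 + O(h)` and the scheme is consistent. -/
theorem IsLinearSolution.unique {κ : ℝ} {M : ℝ≥0 → Mat d} {f g : ℝ≥0 → P1 d}
    (hf : IsLinearSolution κ M f) (hg : IsLinearSolution κ M g) (h0 : f 0 = g 0) : f = g := by
  funext t
  refine P1.ext_of_pairing fun ψ hψ hψs => ?_
  obtain ⟨R, a, ha, hclass⟩ := exists_testClass hψ hψs
  obtain ⟨C, hC0, hC⟩ := exists_driftBound d κ R
  let D : (Mat d × Mat d → ℝ) → ℝ → ℝ := fun φ t =>
    pairing φ (f t.toNNReal) - pairing φ (g t.toNNReal)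
  let N : ℝ → ℝ := fun t => ⨆ φ : {φ : Mat d × Mat d → ℝ // TestClass R 1 φ}, |D φ.1 t|
  have hne : Nonempty {φ : Mat d × Mat d → ℝ // TestClass R 1 φ} := ⟨⟨_, testClass_zero R⟩⟩
  have hbdd : ∀ t, BddAbove (range fun φ : {φ : Mat d × Mat d → ℝ // TestClass R 1 φ} =>
      |D φ.1 t|) := by
    intro t
    refine ⟨2, ?_⟩
    rintro _ ⟨φ, rfl⟩
    have h1 := abs_pairing_le φ.2 (f t.toNNReal)
    have h2 := abs_pairing_le φ.2 (g t.toNNReal)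
    exact (abs_sub _ _).trans (by linarith)
  have hDN : ∀ φ t, TestClass R 1 φ → |D φ t| ≤ N t := fun φ t hφ => le_ciSup (hbdd t) ⟨φ, hφ⟩
  have hDa : ∀ φ t a, 0 < a → TestClass R a φ → |D φ t| ≤ a * N t := by
    intro φ t a ha hφ
    have h1 := hφ.const_mul (inv_nonneg.2 ha.le)
    rw [inv_mul_cancel₀ ha.ne'] at h1
    have h2 := hDN _ t h1
    have h3 : D (fun z => a⁻¹ * φ z) t = a⁻¹ * D φ t := by
      simp only [D, pairing, integral_const_mul, mul_sub]
    rw [h3, abs_mul, abs_of_pos (inv_pos.2 ha), inv_mul_le_iff₀ ha] at h2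
    exact h2
  have hlip : ∀ s t, 0 ≤ s → 0 ≤ t → N t ≤ N s + 2 * C * |t - s| := by
    intro s t hs ht
    refine ciSup_le fun φ => ?_
    have h1 := hf.abs_pairing_sub_le φ.2.smooth φ.2.vanish
      (fun m x => φ.2.abs_fderiv_le hC0 hC m x) hs ht
    have h2 := hg.abs_pairing_sub_le φ.2.smooth φ.2.vanish
      (fun m x => φ.2.abs_fderiv_le hC0 hC m x) hs ht
    have h3 := hDN φ.1 s φ.2
    simp only [D] at h3 ⊢
    rw [abs_le] at h1 h2 h3 ⊢
    constructor <;> linarith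
  have hcont : ContinuousOn N (Icc 0 (t : ℝ)) := by
    refine (LipschitzOnWith.of_dist_le_mul (K := ⟨2 * C, by positivity⟩)
      fun r hr s hs => ?_).continuousOn
    rw [Real.dist_eq, Real.dist_eq, abs_le]
    have h1 := hlip s r hs.1 hr.1
    have h2 := hlip r s hr.1 hs.1
    rw [abs_sub_comm] at h2
    constructor
    · change -(2 * C * |r - s|) ≤ _
      linarith
    · change _ ≤ 2 * C * |r - s|
      linarith
  let Γ := 3 * C + C ^ 2
  have hΓ : 0 ≤ Γ := by positivity
  have hslope : ∀ s ∈ Ico 0 (t : ℝ), ∀ r, Γ * N s < r →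
      ∃ᶠ z in 𝓝[>] s, (z - s)⁻¹ * (N z - N s) < r := by
    intro s hs r hr
    -- Two consistency errors, for `f` and `g`, take up half of the gap `r - Γ * N s`.
    have hε : 0 < (r - Γ * N s) / 4 := by linarith
    have hev : ∀ᶠ h in 𝓝[>] (0 : ℝ), h⁻¹ * (N (s + h) - N s) < r := by
      filter_upwards [hf.eventually_abs_pairing_sub_le hC0 hC hs.1 hε,
        hg.eventually_abs_pairing_sub_le hC0 hC hs.1 hε,
        Ioo_mem_nhdsGT (zero_lt_one (α := ℝ))] with h h1 h2 hh
      have hN : N (s + h) ≤ (1 + h * Γ) * N s + 2 * ((r - Γ * N s) / 4 * h) := by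
        refine ciSup_le fun φ => ?_
        have hφ := φ.2.comp_eulerStep hC0 hC (M s.toNNReal) hh.1.le hh.2.le
        have hpos : 0 < 1 + h * Γ := by
          have := mul_nonneg hh.1.le hΓ
          linarith
        have h3 := hDa _ s _ hpos hφ
        have h4 := h1 φ.1 φ.2
        have h5 := h2 φ.1 φ.2
        simp only [D] at h3 ⊢
        rw [abs_le] at h3 h4 h5 ⊢
        constructor <;> linarith
      rw [inv_mul_lt_iff₀ hh.1]
      have : h * (Γ * N s) < h * r := mul_lt_mul_of_pos_left hr hh.1
      linarith
    have hmap : Tendsto (fun z => z - s) (𝓝[>] s) (𝓝[>] 0) := by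
      refine tendsto_nhdsWithin_iff.2 ⟨?_, ?_⟩
      · have : Tendsto (fun z => z - s) (𝓝 s) (𝓝 (s - s)) := (continuous_sub_right s).tendsto s
        rw [sub_self] at this
        exact this.mono_left nhdsWithin_le_nhds
      · filter_upwards [self_mem_nhdsWithin] with z hz
        exact sub_pos.2 (mem_Ioi.1 hz)
    refine Eventually.frequently ((hmap.eventually hev).mono fun z hz => ?_)
    rwa [add_sub_cancel] at hz
  have hN0 : N 0 ≤ 0 := ciSup_le fun φ => by simp [D, h0]
  have hgron := le_gronwallBound_of_liminf_deriv_right_le hcont hslope hN0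
    (fun s _ => (add_zero (Γ * N s)).ge) t ⟨t.2, le_rfl⟩
  rw [gronwallBound_ε0_δ0] at hgron
  have hfin := hDa ψ t a ha hclass
  have : |D ψ t| ≤ 0 := hfin.trans (mul_nonpos_of_nonneg_of_nonpos ha.le hgron)
  have hz := abs_nonpos_iff.1 this
  simp only [D, Real.toNNReal_coe] at hz
  exact sub_eq_zero.1 hz

/-! ### The nonlinear equation -/

/-- The average of `U(t, ·)` under the initial datum. -/
noncomputable def initialMean (f₀ : P1 d) (U : ℝ≥0 × Phase d → Mat d) (t : ℝ≥0) : Mat d :=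
  ∫ x, U (t, x) ∂f₀.1.toMeasure

theorem ExpBounded.integrable {lam : ℝ} {U : ℝ≥0 × Phase d → Mat d} (hU : ExpBounded lam U)
    (f₀ : P1 d) (t : ℝ≥0) : Integrable (fun x => U (t, x)) f₀.1.toMeasure := by
  obtain ⟨C, hC⟩ := hU.bound
  exact .of_bound (hU.continuous.comp (Continuous.prodMk_right t)).aestronglyMeasurable
    (C * Real.exp (lam * t)) (ae_of_all _ fun x => hC (t, x))

theorem ExpBounded.continuous_initialMean {lam : ℝ} (hl : 0 ≤ lam) {U : ℝ≥0 × Phase d → Mat d}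
    (hU : ExpBounded lam U) (f₀ : P1 d) : Continuous (initialMean f₀ U) := by
  obtain ⟨C, hC⟩ := hU.bound
  rw [continuous_iff_continuousAt]
  intro t
  refine continuousAt_of_dominated (bound := fun _ => |C| * Real.exp (lam * (t + 1)))
    (Eventually.of_forall fun s => (hU.integrable f₀ s).aestronglyMeasurable) ?_
    (integrable_const _)
    (ae_of_all _ fun x => (hU.continuous.comp (Continuous.prodMk_left x)).continuousAt)
  have hlt : ∀ᶠ s in 𝓝 t, s < t + 1 := eventually_lt_nhds (lt_add_one t)
  filter_upwards [hlt] with s hs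
  refine ae_of_all _ fun x => (hC (s, x)).trans ?_
  have : (s : ℝ) ≤ t + 1 := by exact_mod_cast hs.le
  gcongr
  exact le_abs_self C

theorem norm_initialMean_sub_le {lam D : ℝ} {U V : ℝ≥0 × Phase d → Mat d}
    (hU : ExpBounded lam U) (hV : ExpBounded lam V) (f₀ : P1 d)
    (h : ∀ p, ‖U p - V p‖ ≤ D * Real.exp (lam * p.1)) (t : ℝ≥0) :
    ‖initialMean f₀ U t - initialMean f₀ V t‖ ≤ D * Real.exp (lam * t) := by
  unfold initialMean
  rw [← integral_sub (hU.integrable f₀ t) (hV.integrable f₀ t)]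
  exact (norm_integral_le_of_norm_le_const (C := D * Real.exp (lam * t))
    (ae_of_all _ fun x => h (t, x))).trans (by simp)

theorem IsFlow.mean_push {κ : ℝ} {M : ℝ≥0 → Mat d} {T : ℝ≥0 → Phase d → Phase d}
    (hT : IsFlow κ M T) (f₀ : P1 d) (t : ℝ≥0) :
    mean (hT.push f₀ t).1.toMeasure = initialMean f₀ (fun p => ((T p.1 p.2).1 : Mat d)) t := by
  rw [hT.toMeasure_push]
  exact integral_map (hT.continuous_apply t).measurable.aemeasurable
    continuous_coe_fst.aestronglyMeasurable

/-- Every weak solution is the push-forward of its initial datum under the linear flow driven by its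
own average, and hence comes from a solution of the nonlinear Duhamel equation. -/
theorem IsCauchySolution.exists_eq_push {κ : ℝ} {f₀ : P1 d} {lam : ℝ} (hlam : IsDuhamelRate d κ lam)
    {f : ℝ≥0 → P1 d} (hf : IsCauchySolution κ f₀ f) :
    ∃ (M : ℝ≥0 → Mat d) (T : ℝ≥0 → Phase d → Phase d) (hT : IsFlow κ M T), f = hT.push f₀ ∧
      ExpBounded lam (fun p : ℝ≥0 × Phase d => ((T p.1 p.2).1 : Mat d)) ∧
      duhamel κ (initialMean f₀ fun p => ((T p.1 p.2).1 : Mat d))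
        (fun p => ((T p.1 p.2).1 : Mat d)) = fun p => ((T p.1 p.2).1 : Mat d) := by
  let M : ℝ≥0 → Mat d := fun t => mean (f t).1.toMeasure
  have hM : Continuous M := hf.continuous.continuous_mean
  have hMd : ∀ t, ‖M t‖ ≤ d := fun t => norm_mean_le _
  obtain ⟨U, ⟨hU, hfix⟩, -⟩ := hlam (fun _ => M) (fun _ _ => hM) fun U V _ _ D hD t => by
    rw [sub_self, norm_zero]
    have : Nonempty (Phase d) := ⟨(1, 0)⟩
    exact (norm_nonneg _).trans (hD (t, Classical.arbitrary _))
  obtain ⟨T, hT, hTU⟩ := exists_isFlow hM hU.continuous hfix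
  have hTU' : (fun p : ℝ≥0 × Phase d => ((T p.1 p.2).1 : Mat d)) = U :=
    funext fun p => hTU p.1 p.2
  have h1 : IsLinearSolution κ M f := ⟨hM, hMd, hf.continuous, isWeakSolution_iff.1 hf.weak⟩
  have h2 : IsLinearSolution κ M (hT.push f₀) :=
    ⟨hM, hMd, hT.continuousMK1_push f₀, hT.isLinearWeakSolution_push hM f₀⟩
  have heq : f = hT.push f₀ := h1.unique h2 (by rw [hf.initial, hT.push_zero])
  refine ⟨M, T, hT, heq, by rwa [hTU'], ?_⟩
  have hmean : (initialMean f₀ fun p => ((T p.1 p.2).1 : Mat d)) = M := by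
    funext t
    rw [← hT.mean_push, ← heq]
  rw [hmean]
  exact hT.duhamel
end Lohe

theorem mainTheorem4 (d : ℕ) (κ : ℝ) (hκ : 0 ≤ κ) (f₀ : Lohe.P1 d) :
    (∃! f : ℝ≥0 → Lohe.P1 d, Lohe.IsCauchySolution κ f₀ f) ∧
    ∀ f : ℝ≥0 → Lohe.P1 d, Lohe.IsCauchySolution κ f₀ f →
      ∀ p : ℝ, 1 ≤ p → Lohe.HasFiniteMoment p f₀.1.toMeasure →
        ∀ t : ℝ≥0, Lohe.HasFiniteMoment p (f t).1.toMeasure := by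
  open Lohe in
  obtain ⟨lam, hl, hlam⟩ := exists_isDuhamelRate d hκ
  obtain ⟨U, ⟨hU, hfix⟩, huniq⟩ := hlam (initialMean f₀)
    (fun U hU => hU.continuous_initialMean hl f₀)
    (fun U V hU hV D hD => norm_initialMean_sub_le hU hV f₀ hD)
  have hM := hU.continuous_initialMean hl f₀
  obtain ⟨T, hT, hTU⟩ := exists_isFlow hM hU.continuous hfix
  refine ⟨⟨hT.push f₀, ⟨hT.continuousMK1_push f₀, ?_, hT.push_zero f₀⟩, fun g hg => ?_⟩, ?_⟩
  · have hmean : (fun t => mean (hT.push f₀ t).1.toMeasure) = initialMean f₀ U := by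
      funext t
      rw [hT.mean_push]
      simp only [hTU]
    rw [isWeakSolution_iff, hmean]
    exact hT.isLinearWeakSolution_push hM f₀
  · obtain ⟨M', S, hS, rfl, hSb, hSfix⟩ := hg.exists_eq_push hlam
    have hSU := huniq _ ⟨hSb, hSfix⟩
    have hST : S = T := by
      funext t x
      refine Prod.ext (Subtype.ext ?_) ((hS.snd t x).trans (hT.snd t x).symm)
      rw [hTU]
      exact congrFun hSU (t, x)
    subst hST
    rfl
  · intro f hf p hp hmom t
    obtain ⟨M', S, hS, rfl, -⟩ := hf.exists_eq_push hlam
    exact hmom.map hp (hS.continuous_apply t).measurable (hS.snd t)
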